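/- Let $\mathcal X$ be a finite set with $n$ elements, and let $w:\mathcal X\times\mathcal X\to[0,\infty)$ be transition rates. Put $w(x)=\sum_{y\ne x}w(x,y)$, $\alpha=\max_x w(x)$, and assume $\alpha>0$. Let $\mathcal L$ be the generator, seen as the matrix with $\mathcal L(x,y)=w(x,y)$ for $x\neq y$ and $\mathcal L(x,x)=-w(x)$. Assume that the stochastic matrix $P=\mathrm{Id}+\mathcal L/\alpha$ is irreducible, and that $\mathcal L$ is reversible with respect to a probability measure $\mu$: $\mu(x)w(x,y)=\mu(y)w(y,x)$ for all $x,y$. Let $X$ be the associated continuous-time Markov process, which makes its jumps (possibly trivial) according to $P$ at the events $\tau_1<\tau_2<\cdots$ of a Poisson process of rate $\alpha$. Let $0=\lambda_0<\lambda_1\le\cdots\le\lambda_{n-1}$ be the eigenvalues of $-\mathcal L$, with multiplicity. For $q'>0$ let $K_{q'}=q'(q'\,\mathrm{Id}-\mathcal L)^{-1}$. Let $q,q'>0$. A spanning oriented forest $\phi$ is a spanning collection of rooted trees made of oriented edges $(x,y)$ with $w(x,y)>0$, each tree being oriented towards its root; $\rho(\phi)$ is its set of roots. Let $\Phi$ be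 a random spanning oriented forest, defined on a probability space with probability $\mathbb P_q$ and expectation $\mathbb E_q$, with law $$\pi_q(\phi)=\frac{1}{Z(q)}\,q^{|\rho(\phi)|}\prod_{e\in\phi}w(e),$$ where $Z(q)$ is the normalizing constant. Set $\bar{\mathcal X}=\rho(\Phi)$, let $\Lambda=K_{q'}|_{\bar{\mathcal X}\times\mathcal X}$ (its rows are the probability measures $\nu_{\bar x}=K_{q'}(\bar x,\cdot)$, $\bar x\in\bar{\mathcal X}$), and let $\bar P$ be the transition matrix of the trace chain on $\bar{\mathcal X}$: $\bar P(\bar x,\bar y)=P_{\bar x}[X(H^+)=\bar y]$ with $H^+=\inf\{t\ge\tau_1: X(t)\in\bar{\mathcal X}\}$. Let $d_{TV}(\nu,\nu')=\frac12\sum_x|\nu(x)-\nu'(x)|$. The squeezing of $\Lambda$ is defined through the Gram matrix $\Gamma(\bar x,\bar y)=\sum_{x}\nu_{\bar x}(x)\nu_{\bar y}(x)/\mu(x)$ by $\mathcal S(\Lambda)=\sqrt{\mathrm{Trace}(\Gamma^{-1})}$ if $\det\Gamma\neq0$, and $\mathcal S(\Lambda)=+\infty$ otherwise. Let $p_j=\frac{q}{q+\lambda_j}$,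 $p'_j=\frac{q'}{q'+\lambda_j}$ and $$S_n=\sum_{j=1}^{n-1}p_j'^2(1-p_j)^2,\qquad T_n=\sum_{j=1}^{n-1}\frac{p_j^2}{p_j'^2},\qquad V_n=\sum_{j=1}^{n-1}p_j(1-p_j).$$ Then for every $m\in\{1,\dots,n\}$, $$\mathbb E_q\Bigl[\sum_{\bar x\in\bar{\mathcal X}}d_{TV}\bigl(\Lambda P(\bar x,\cdot),\bar P\Lambda(\bar x,\cdot)\bigr)\Bigm||\bar{\mathcal X}|=m\Bigr]\le\frac{q'(n-m)}{\alpha};$$ moreover $$\mathbb E_q\Bigl[\sum_{\bar x\in\bar{\mathcal X}}d_{TV}\bigl(\Lambda P(\bar x,\cdot),\bar P\Lambda(\bar x,\cdot)\bigr)\Bigr]\le\frac{q'}{\alpha}\sum_{i=1}^{n-1}\frac{\lambda_i}{q+\lambda_i};$$ and for every $m\in\{1,\dots,n\}$, $$\mathbb E_q\bigl[\mathcal S(\Lambda)\bigm||\bar{\mathcal X}|=m\bigr]\le\frac{\min\Bigl\{\sqrt{1+\sqrt{T_n/S_n}}\;\exp\bigl(\sqrt{S_nT_n}-V_n\bigr),\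 \sqrt{1+T_n}\;\exp\bigl(\tfrac{1+S_nT_n}{2}-V_n\bigr)\Bigr\}}{\mathbb P_q\bigl[|\bar{\mathcal X}|=m\bigr]}.$$ -/

import Mathlib

open MeasureTheory ProbabilityTheory
open scoped NNReal ENNReal

namespace ForestIntertwining

noncomputable section

/-! ### Reversible jump processes on a finite state space

Throughout, `w x y` is the rate of the jump from `x` to `y`; the diagonal values of `w` play
no role. -/

/-- The total rate `w(x) = ∑_{y ≠ x} w(x, y)` of leaving `x`. -/
def exitRate {X : Type*} [Fintype X] [DecidableEq X] (w : X → X → ℝ≥0) (x : X) : ℝ≥0 :=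
  ∑ y ∈ Finset.univ.erase x, w x y

/-- The maximal exit rate `α = max_x w(x)`. -/
def maxRate {X : Type*} [Fintype X] [DecidableEq X] (w : X → X → ℝ≥0) : ℝ≥0 :=
  Finset.univ.sup (exitRate w)

/-- The generator `L` as a matrix: `L(x, y) = w(x, y)` for `x ≠ y` and `L(x, x) = -w(x)`. -/
def generator {X : Type*} [Fintype X] [DecidableEq X] (w : X → X → ℝ≥0) : Matrix X X ℝ :=
  Matrix.of fun x y => if x = y then -(exitRate w x : ℝ) else (w x y : ℝ)

/-- The transition matrix `P = L / α + Id` of the discrete skeleton of the process. -/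
def transitionMatrix {X : Type*} [Fintype X] [DecidableEq X] (w : X → X → ℝ≥0) :
    Matrix X X ℝ :=
  (maxRate w : ℝ)⁻¹ • generator w + 1

/-- The kernel `K_{q'} = q' (q' Id - L)⁻¹`: the law of the process at an independent exponential
time of parameter `q'`. -/
def resolventKernel {X : Type*} [Fintype X] [DecidableEq X] (w : X → X → ℝ≥0) (q' : ℝ) :
    Matrix X X ℝ :=
  q' • (q' • (1 : Matrix X X ℝ) - generator w)⁻¹

/-- `μ` is a probability measure satisfying detailed balance for the rates `w`. -/
structure IsReversible {X : Type*} [Fintype X] (w : X → X → ℝ≥0) (μ : X → ℝ) : Prop where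
  nonneg : ∀ x, 0 ≤ μ x
  sum_eq_one : ∑ x, μ x = 1
  detailed_balance : ∀ x y, μ x * (w x y : ℝ) = μ y * (w y x : ℝ)

/-- The list of the real eigenvalues of `-L` in increasing order, with multiplicity. -/
def spectrumList {X : Type*} [Fintype X] [DecidableEq X] (w : X → X → ℝ≥0) : List ℝ :=
  (-generator w).charpoly.roots.sort (· ≤ ·)

/-- The eigenvalue `λ_j` of `-L`, where `λ_0 ≤ λ_1 ≤ ⋯ ≤ λ_{n-1}` and `n = |X|`. -/
def eigenvalue {X : Type*} [Fintype X] [DecidableEq X] (w : X → X → ℝ≥0) (j : ℕ) : ℝ :=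
  (spectrumList w).getD j 0

/-! ### The law of the discrete skeleton -/

theorem exitRate_le_maxRate {X : Type*} [Fintype X] [DecidableEq X] (w : X → X → ℝ≥0) (x : X) :
    exitRate w x ≤ maxRate w :=
  Finset.le_sup (f := exitRate w) (Finset.mem_univ x)

theorem transitionMatrix_nonneg {X : Type*} [Fintype X] [DecidableEq X] (w : X → X → ℝ≥0)
    (x y : X) : 0 ≤ transitionMatrix w x y := by
  have h : (exitRate w x : ℝ) ≤ maxRate w := by exact_mod_cast exitRate_le_maxRate w x
  by_cases hxy : x = y
  · subst hxy
    simp only [transitionMatrix, generator, Matrix.add_apply, Matrix.smul_apply, Matrix.of_apply,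
      if_true, Matrix.one_apply_eq, smul_eq_mul, mul_neg]
    have h1 : (maxRate w : ℝ)⁻¹ * (exitRate w x : ℝ) ≤ 1 := by
      rw [mul_comm, ← div_eq_mul_inv]
      exact div_le_one_of_le₀ h (maxRate w).coe_nonneg
    linarith
  · simp only [transitionMatrix, generator, Matrix.add_apply, Matrix.smul_apply, Matrix.of_apply,
      if_neg hxy, Matrix.one_apply_ne hxy, smul_eq_mul, add_zero]
    positivity

theorem sum_transitionMatrix {X : Type*} [Fintype X] [DecidableEq X] (w : X → X → ℝ≥0)
    (x : X) : ∑ y, transitionMatrix w x y = 1 := by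
  have h : ∑ y, generator w x y = 0 := by
    rw [← Finset.add_sum_erase _ _ (Finset.mem_univ x)]
    have h2 : ∑ y ∈ Finset.univ.erase x, generator w x y = (exitRate w x : ℝ) := by
      simp only [exitRate, NNReal.coe_sum]
      refine Finset.sum_congr rfl fun y hy => ?_
      simp [generator, (Finset.ne_of_mem_erase hy).symm]
    rw [h2]
    simp [generator]
  simp only [transitionMatrix, Matrix.add_apply, Matrix.smul_apply, smul_eq_mul,
    Finset.sum_add_distrib, ← Finset.mul_sum, h, mul_zero, zero_add]
  simp [Matrix.one_apply]

/-- The probability measure `P(x, ·)`. -/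
def stepMeasure {X : Type*} [Fintype X] [DecidableEq X] [MeasurableSpace X]
    (w : X → X → ℝ≥0) (x : X) : Measure X :=
  ∑ y, ENNReal.ofReal (transitionMatrix w x y) • Measure.dirac y

instance isProbabilityMeasure_stepMeasure {X : Type*} [Fintype X] [DecidableEq X]
    [MeasurableSpace X] (w : X → X → ℝ≥0) (x : X) : IsProbabilityMeasure (stepMeasure w x) := by
  constructor
  simp only [stepMeasure, Measure.coe_finsetSum, Measure.smul_apply, Finset.sum_apply,
    measure_univ, smul_eq_mul, mul_one]
  rw [← ENNReal.ofReal_sum_of_nonneg fun y _ => transitionMatrix_nonneg w x y,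
    sum_transitionMatrix, ENNReal.ofReal_one]

/-- One step of the chain with transition matrix `P`: from the trajectory up to time `k`, jump
according to `P` from the current position. -/
def chainStep {X : Type*} [Fintype X] [DecidableEq X] [MeasurableSpace X]
    [DiscreteMeasurableSpace X] (w : X → X → ℝ≥0) (k : ℕ) :
    Kernel ((i : Finset.Iic k) → (fun _ : ℕ => X) i) X :=
  (Kernel.ofFunOfCountable (stepMeasure w)).comap
    (fun h => h ⟨k, Finset.mem_Iic.2 le_rfl⟩) (measurable_pi_apply _)

instance isMarkovKernel_chainStep {X : Type*} [Fintype X] [DecidableEq X] [MeasurableSpace X]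
    [DiscreteMeasurableSpace X] (w : X → X → ℝ≥0) (k : ℕ) : IsMarkovKernel (chainStep w k) :=
  ⟨fun h => isProbabilityMeasure_stepMeasure w (h ⟨k, Finset.mem_Iic.2 le_rfl⟩)⟩

/-- The law, on trajectories `ℕ → X`, of the Markov chain with transition matrix `P` started
from `x`. -/
def chainLaw {X : Type*} [Fintype X] [DecidableEq X] [MeasurableSpace X]
    [DiscreteMeasurableSpace X] (w : X → X → ℝ≥0) (x : X) : Measure (ℕ → X) :=
  Kernel.traj (X := fun _ : ℕ => X) (chainStep w) 0 (fun _ => x)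

/-- The transition matrix of the trace chain on `R`: the `(x, y)` entry is the probability that
the process started from `x` is at `y` at its return time to `R`. The process in continuous time
follows the skeleton `ω` and makes its `k`-th step at the `k`-th event of a Poisson process of
rate `α`, and the return time is the first time after the first event at which the process
is in `R`; so the position at that time is the position of the skeleton at the first step `k ≥ 1`
with `ω k ∈ R`. -/
def traceKernel {X : Type*} [Fintype X] [DecidableEq X] [MeasurableSpace X]
    [DiscreteMeasurableSpace X] (w : X → X → ℝ≥0) (R : Finset X) : Matrix R R ℝ :=
  Matrix.of fun x y =>
    (chainLaw w (x : X)).real {ω | ∃ k : ℕ, IsLeast {i : ℕ | 1 ≤ i ∧ ω i ∈ R} k ∧ ω k = y}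

/-! ### Total variation error and squeezing -/

/-- Total variation distance between two probability measures on a finite set. -/
def tvDist {X : Type*} [Fintype X] (ν ν' : X → ℝ) : ℝ :=
  (1 / 2) * ∑ x, |ν x - ν' x|

/-- The rectangular stochastic matrix `Λ = K_{q'}|_{R × X}`. -/
def linkMatrix {X : Type*} [Fintype X] [DecidableEq X] (w : X → X → ℝ≥0) (q' : ℝ)
    (R : Finset X) : Matrix R X ℝ :=
  Matrix.of fun x y => resolventKernel w q' (x : X) y

/-- The intertwining error `∑_{x ∈ R} d_TV(ΛP(x, ·), P̄Λ(x, ·))`. -/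
def intertwiningError {X : Type*} [Fintype X] [DecidableEq X] [MeasurableSpace X]
    [DiscreteMeasurableSpace X] (w : X → X → ℝ≥0) (q' : ℝ) (R : Finset X) : ℝ :=
  ∑ x : R, tvDist ((linkMatrix w q' R * transitionMatrix w) x)
    ((traceKernel w R * linkMatrix w q' R) x)

/-- The Gram matrix `Γ = Λ D(1/μ) Λᵗ` of the rows of `Λ` in `ℓ₂*(μ)`. -/
def gramMatrix {X Y : Type*} [Fintype X] [DecidableEq X] (μ : X → ℝ) (M : Matrix Y X ℝ) :
    Matrix Y Y ℝ :=
  M * Matrix.diagonal (fun x => 1 / μ x) * M.transpose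

/-- The squeezing of the rows of `Λ`: it is `+∞` if `det Γ = 0`, and `√(Trace(Γ⁻¹))` otherwise. -/
def squeezing {X Y : Type*} [Fintype X] [DecidableEq X] [Fintype Y] [DecidableEq Y]
    (μ : X → ℝ) (M : Matrix Y X ℝ) : ℝ≥0∞ :=
  open scoped Classical in
  if (gramMatrix μ M).det = 0 then ⊤
  else ENNReal.ofReal (Real.sqrt ((gramMatrix μ M)⁻¹.trace))

/-! ### Random spanning oriented forests -/

/-- A spanning oriented forest of the oriented graph `{(x, y) : w(x, y) > 0}`, given by its set of
oriented edges: every vertex has at most one outgoing edge (towards the root of its tree), and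
there is no oriented cycle. -/
@[ext]
structure SpanningForest {X : Type*} (w : X → X → ℝ≥0) where
  /-- the set of oriented edges -/
  edges : Finset (X × X)
  pos : ∀ x y, (x, y) ∈ edges → 0 < w x y
  out_unique : ∀ x y z, (x, y) ∈ edges → (x, z) ∈ edges → y = z
  acyclic : ∀ x, ¬ Relation.TransGen (fun a b => (a, b) ∈ edges) x x

instance fintypeSpanningForest {X : Type*} [Fintype X] (w : X → X → ℝ≥0) :
    Fintype (SpanningForest w) :=
  open scoped Classical in
  Fintype.ofInjective SpanningForest.edges fun _ _ h => SpanningForest.ext h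

instance measurableSpaceSpanningForest {X : Type*} (w : X → X → ℝ≥0) :
    MeasurableSpace (SpanningForest w) := ⊤

/-- The set of roots `ρ(φ)`: the vertices without outgoing edge. -/
def roots {X : Type*} [Fintype X] {w : X → X → ℝ≥0} (φ : SpanningForest w) : Finset X :=
  open scoped Classical in
  Finset.univ.filter fun x => ∀ y, (x, y) ∉ φ.edges

/-- The weight `w_q(φ) = q^{|ρ(φ)|} ∏_{e ∈ φ} w(e)`. -/
def forestWeight {X : Type*} [Fintype X] {w : X → X → ℝ≥0} (q : ℝ) (φ : SpanningForest w) : ℝ :=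
  q ^ (roots φ).card * ∏ e ∈ φ.edges, (w e.1 e.2 : ℝ)

/-- The partition function `Z(q)`. -/
def partitionFunction {X : Type*} [Fintype X] (w : X → X → ℝ≥0) (q : ℝ) : ℝ :=
  ∑ φ : SpanningForest w, forestWeight q φ

/-- The law `π_q` on spanning oriented forests: `π_q(φ) = w_q(φ) / Z(q)`. -/
def forestLaw {X : Type*} [Fintype X] (w : X → X → ℝ≥0) (q : ℝ) :
    Measure (SpanningForest w) :=
  ∑ φ : SpanningForest w,
    ENNReal.ofReal (forestWeight q φ / partitionFunction w q) • Measure.dirac φ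

/-! ### Spectral sums -/

/-- `p_j = q / (q + λ_j)`. -/
def specProb {X : Type*} [Fintype X] [DecidableEq X] (w : X → X → ℝ≥0) (q : ℝ) (j : ℕ) : ℝ :=
  q / (q + eigenvalue w j)

/-- `S_n = ∑_{j=1}^{n-1} p'_j² (1 - p_j)²`. -/
def sumS {X : Type*} [Fintype X] [DecidableEq X] (w : X → X → ℝ≥0) (q q' : ℝ) : ℝ :=
  ∑ j ∈ Finset.Ico 1 (Fintype.card X), specProb w q' j ^ 2 * (1 - specProb w q j) ^ 2

/-- `T_n = ∑_{j=1}^{n-1} p_j² / p'_j²`. -/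
def sumT {X : Type*} [Fintype X] [DecidableEq X] (w : X → X → ℝ≥0) (q q' : ℝ) : ℝ :=
  ∑ j ∈ Finset.Ico 1 (Fintype.card X), specProb w q j ^ 2 / specProb w q' j ^ 2

/-- `V_n = ∑_{j=1}^{n-1} p_j (1 - p_j)`. -/
def sumV {X : Type*} [Fintype X] [DecidableEq X] (w : X → X → ℝ≥0) (q : ℝ) : ℝ :=
  ∑ j ∈ Finset.Ico 1 (Fintype.card X), specProb w q j * (1 - specProb w q j)

end

end ForestIntertwining

open ForestIntertwining

/-!
Approximate intertwining of a reversible jump process with its trace on the roots of a random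
spanning forest.

Write `A = -L`, and let `rowMinor A R` be the principal minor of `A` outside `R`. The matrix forest
theorem `sum_edgeWeight_roots_eq` says that the forests with root set `R` have total weight
`rowMinor A R`, so that the root set is `R` with probability `q ^ |R| * rowMinor A R / Z(q)`, where
`Z(q) = det (q - L)`. It is proved by expanding every row of `A` as `∑ y, w x y (e_x - e_y)`: the
determinant splits over the functions `r : X → X` fixing `R`, and the determinant with rows
`e_x - e_{r x}` outside `R` is `1` or `0` according to whether `r` is acyclic.

*Intertwining error.* Let `Q` be the skeleton chain killed on `R`, and `G = (1 - Q)⁻¹`. The one-step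
Markov property shows that the trace chain is the restriction of `P G` (`traceKernel_eq`), while
the resolvent equation gives `K = G K'`, where `K'` has the rows of `K` in `R` and the rows of
`(q'/α) (1 - K)` outside it. As `K` commutes with `P`, the error is a sum over the points outside
`R` only, and it is at most `(q'/α) ∑_{x ∈ R} (P h)(x)` with `h` the hitting time of `R`
(`intertwiningError_le`). Conditionally on `|R| = m` the mean of `h` does not depend on the starting
point: by Cramer's rule its generating function in `q` is `det (q + A) / q` (`sum_cramer_mixRows`).
So the mean of `(P - 1) h` vanishes; as `(P - 1) h` is `-1` outside `R`, its sum over `R` has mean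
`n - m`. Averaging over `m` gives the unconditional bound, since the mean number of non-roots is
`∑ (1 - p_i)`.

*Squeezing.* Let `V` be an orthogonal matrix diagonalizing the symmetrized generator. By the
Cauchy–Binet formula, the law of the roots and the Gram determinants expand over the same
nonnegative coefficients `minorSq V R J = det (V_{R,J})²`:
`ℙ[roots = R] = ∑_J ∏_J p ∏_{Jᶜ} (1 - p) det (V_{R,J})²` and
`det (K²)_R = ∑_J ∏_J p'² det (V_{R,J})²`, with `K` symmetrized by `μ`. The Cauchy–Schwarz
inequality, applied first in `J` and then in `R`, bounds the expectation of `√Trace(Γ⁻¹)` on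
`|R| = m` by `√(a b)`, where `a` and `b` are at most the coefficients of `y ^ m` in
`∏ (y p²/p'² + (1 - p)²)` and of `y ^ (m - 1)` in `∏ (1 + y p'²)`. Bounding a coefficient by the
value of the generating function, at `y` for `a` and at `1/y` for `b`, gives
`√(1 + 1/y) exp ((y T + S/y)/2 - ∑ p (1 - p))` for every `y > 0`
(`SpectralData.sum_sqrt_mul_sqrt_le`); the two terms of the minimum are the choices `y = √(S/T)`
and `y = 1/T`.
-/

namespace ForestIntertwining

noncomputable section

/-! ### Principal minors -/

section Minor

variable {X : Type*} [Fintype X] [DecidableEq X]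

/-- The matrix with the rows of `A` in `R` and the rows of `B` outside `R`. -/
def mixRows (R : Finset X) (A B : Matrix X X ℝ) : Matrix X X ℝ :=
  Matrix.of fun x y => if x ∈ R then A x y else B x y

theorem det_add_eq_sum_mixRows (A B : Matrix X X ℝ) :
    (A + B).det = ∑ R : Finset X, (mixRows R A B).det := by
  have h := (Matrix.detRowAlternating (n := X) (R := ℝ)).toMultilinearMap.map_add_univ
    (fun x => A x) (fun x => B x)
  refine h.trans (Finset.sum_congr rfl fun R _ => ?_)
  change Matrix.det (Matrix.of (R.piecewise (fun x => A x) fun x => B x)) = _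
  congr 1
  ext x y
  by_cases hx : x ∈ R <;> simp [hx, mixRows, Finset.piecewise]

theorem det_scaleRows (R : Finset X) (d : X → ℝ) (M : Matrix X X ℝ) :
    (Matrix.of fun x y => (if x ∈ R then d x else 1) * M x y).det = (∏ x ∈ R, d x) * M.det := by
  rw [Matrix.det_mul_column, Finset.prod_ite_mem,
    Finset.univ_inter]

/-- The principal minor of `A` obtained by deleting the rows and columns in `R`, encoded as the
determinant of the full-size matrix in which the rows in `R` are replaced by those of the
identity. -/
def rowMinor (A : Matrix X X ℝ) (R : Finset X) : ℝ :=
  (mixRows R 1 A).det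

theorem rowMinor_empty (A : Matrix X X ℝ) : rowMinor A ∅ = A.det := by
  rw [rowMinor]; congr 1

theorem rowMinor_univ (A : Matrix X X ℝ) : rowMinor A Finset.univ = 1 := by
  have : mixRows Finset.univ 1 A = 1 := by ext; simp [mixRows]
  rw [rowMinor, this, Matrix.det_one]

theorem det_diagonal_add (d : X → ℝ) (A : Matrix X X ℝ) :
    (Matrix.diagonal d + A).det = ∑ R : Finset X, (∏ x ∈ R, d x) * rowMinor A R := by
  rw [det_add_eq_sum_mixRows]
  refine Finset.sum_congr rfl fun R _ => ?_
  rw [rowMinor, ← det_scaleRows]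
  congr 1
  ext x y
  by_cases hx : x ∈ R <;> simp [hx, mixRows, Matrix.diagonal_apply, Matrix.one_apply]

theorem rowMinor_eq_det_submatrix (A : Matrix X X ℝ) (R : Finset X) :
    rowMinor A R =
      (A.submatrix (Subtype.val : {x // x ∉ R} → X) (Subtype.val : {x // x ∉ R} → X)).det := by
  have h := Matrix.twoBlockTriangular_det' (mixRows R 1 A) (fun x => x ∈ R)
    (fun i hi j hj => by
      have : i ≠ j := fun h => hj (h ▸ hi)
      simp [hi, this, mixRows])
  have h1 : Matrix.toSquareBlockProp (mixRows R 1 A) (fun x => x ∈ R) = 1 := by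
    ext i j
    rw [Matrix.toSquareBlockProp, Matrix.toBlock_apply, mixRows, Matrix.of_apply, if_pos i.2,
      Matrix.one_apply, Matrix.one_apply]
    simp only [Subtype.ext_iff]
  have h2 : Matrix.toSquareBlockProp (mixRows R 1 A) (fun x => ¬ x ∈ R)
      = A.submatrix (Subtype.val : {x // x ∉ R} → X) (Subtype.val : {x // x ∉ R} → X) := by
    ext i j
    simp [Matrix.toSquareBlockProp, Matrix.toBlock_apply, mixRows, i.2]
  rw [rowMinor, h, h1, h2]
  convert one_mul _
  convert Matrix.det_one (n := {x // x ∈ R}) (R := ℝ)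

/-- Minors indexed by the vertices of `R` themselves. -/
theorem rowMinor_compl (A : Matrix X X ℝ) (R : Finset X) :
    rowMinor A Rᶜ = (A.submatrix (Subtype.val : R → X) (Subtype.val : R → X)).det := by
  rw [rowMinor_eq_det_submatrix]
  let e : {x // x ∉ Rᶜ} ≃ R := Equiv.subtypeEquivRight fun x => by simp
  rw [← Matrix.det_submatrix_equiv_self e, Matrix.submatrix_submatrix]
  rfl

theorem rowMinor_nonneg_of_posSemidef {A : Matrix X X ℝ} (hA : A.PosSemidef) (R : Finset X) :
    0 ≤ rowMinor A R := by
  rw [rowMinor_eq_det_submatrix]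
  exact (hA.submatrix _).det_nonneg

theorem rowMinor_diagonal_conj (A : Matrix X X ℝ) (R : Finset X) (d : X → ℝ)
    (hd : ∀ x, d x ≠ 0) :
    rowMinor (Matrix.diagonal (fun x => (d x)⁻¹) * A * Matrix.diagonal d) R = rowMinor A R := by
  have h : mixRows R 1 (Matrix.diagonal (fun x => (d x)⁻¹) * A * Matrix.diagonal d) =
      Matrix.diagonal (fun x => (d x)⁻¹) * mixRows R 1 A * Matrix.diagonal d := by
    ext i j
    by_cases hi : i ∈ R
    · by_cases hij : i = j
      · subst hij; simp [hi, hd, mixRows]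
      · simp [hi, hij, mixRows]
    · simp [hi, mixRows]
  rw [rowMinor, h, Matrix.det_mul_right_comm, Matrix.det_mul, Matrix.diagonal_mul_diagonal,
    rowMinor]
  simp [hd]

end Minor

/-! ### Squared minors of an orthogonal matrix -/

section Orthogonal

variable {X : Type*} [Fintype X] [DecidableEq X]

/-- The block diagonal part of `V` for the blocks `R × J` and `Rᶜ × Jᶜ`. -/
def complPart (V : Matrix X X ℝ) (R J : Finset X) : Matrix X X ℝ :=
  Matrix.of fun x j => if (x ∈ R ↔ j ∈ J) then V x j else 0

/-- For an orthogonal matrix `V`, `det V` times the determinant of its block diagonal part, which is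
up to sign the product of the complementary minors of `V` on `R × J` and `Rᶜ × Jᶜ`. By Jacobi's
complementary minor formula this is the square of the `R × J` minor, that is, the probability that
the determinantal process given by the projection on the columns in `J` is `R`. -/
def minorSq (V : Matrix X X ℝ) (R J : Finset X) : ℝ :=
  V.det * (complPart V R J).det

theorem minorSq_compl (V : Matrix X X ℝ) (R J : Finset X) :
    minorSq V Rᶜ Jᶜ = minorSq V R J := by
  simp [minorSq, complPart, not_iff_not]

theorem minorSq_eq_zero (V : Matrix X X ℝ) {R J : Finset X} (h : R.card ≠ J.card) :
    minorSq V R J = 0 := by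
  suffices (complPart V R J).det = 0 by rw [minorSq, this, mul_zero]
  rw [Matrix.det_apply]
  refine Finset.sum_eq_zero fun σ _ => ?_
  suffices ∃ x, ¬ (σ x ∈ R ↔ x ∈ J) by
    obtain ⟨x, hx⟩ := this
    rw [Finset.prod_eq_zero (Finset.mem_univ x), smul_zero]
    simp [hx, complPart]
  by_contra! hσ
  refine h (Finset.card_bij' (fun x _ => σ.symm x) (fun x _ => σ x) ?_ ?_ ?_ ?_)
  · intro x hx; rw [← hσ]; simpa
  · intro x hx; rwa [hσ]
  · simp
  · simp

theorem sum_minorSq {V : Matrix X X ℝ} (hV : V * V.transpose = 1) (J : Finset X) :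
    ∑ R, minorSq V R J = 1 := by
  have h0 : (Matrix.of fun x j => if j ∈ J then V x j else 0) +
      (Matrix.of fun x j => if j ∈ J then 0 else V x j) = V := by
    ext x j; by_cases hj : j ∈ J <;> simp [hj]
  have h1 : ∑ R : Finset X, (complPart V R J).det = V.det := by
    conv_rhs => rw [← h0, det_add_eq_sum_mixRows]
    refine Finset.sum_congr rfl fun R _ => ?_
    congr 1
    ext x j
    by_cases hx : x ∈ R <;> by_cases hj : j ∈ J <;> simp [hx, hj, mixRows, complPart]
  simp only [minorSq]
  rw [← Finset.mul_sum, h1]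
  have := congrArg Matrix.det hV
  rwa [Matrix.det_mul, Matrix.det_transpose, Matrix.det_one] at this

/-- The Cauchy–Binet formula for the principal minors of `V diag(d) Vᵀ`. -/
theorem rowMinor_conj_diagonal {V : Matrix X X ℝ} (hV : V * V.transpose = 1) (d : X → ℝ)
    (R : Finset X) :
    rowMinor (V * Matrix.diagonal d * V.transpose) R =
      ∑ J : Finset X, (∏ j ∈ Jᶜ, d j) * minorSq V R J := by
  have h : mixRows R 1 (V * Matrix.diagonal d * V.transpose) =
      mixRows R V (V * Matrix.diagonal d) * V.transpose := by
    ext i j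
    by_cases hi : i ∈ R
    · rw [← hV]; simp [hi, Matrix.mul_apply, mixRows]
    · simp only [hi, mixRows, Matrix.mul_apply, Matrix.of_apply, if_false]
  -- split every column into its parts with rows outside `R` and in `R`
  have h0 : (Matrix.of fun j x => if x ∈ R then V x j else 0) +
      (Matrix.of fun j x => if x ∈ R then 0 else d j * V x j) =
      (mixRows R V (V * Matrix.diagonal d)).transpose := by
    ext j x; by_cases hx : x ∈ R <;> simp [hx, mul_comm, mixRows]
  rw [rowMinor, h, Matrix.det_mul, Matrix.det_transpose, mul_comm,
    ← Matrix.det_transpose (mixRows _ _ _), ← h0, det_add_eq_sum_mixRows, Finset.mul_sum]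
  refine Finset.sum_congr rfl fun J _ => ?_
  rw [minorSq, mul_left_comm, ← Matrix.det_transpose (complPart _ _ _),
    ← det_scaleRows]
  congr 2
  ext j x
  by_cases hx : x ∈ R <;> by_cases hj : j ∈ J <;> simp [hx, hj, mixRows, complPart]

theorem rowMinor_compl_conj_diagonal {V : Matrix X X ℝ} (hV : V * V.transpose = 1) (d : X → ℝ)
    (R : Finset X) :
    rowMinor (V * Matrix.diagonal d * V.transpose) Rᶜ =
      ∑ J : Finset X, (∏ j ∈ J, d j) * minorSq V R J := by
  rw [rowMinor_conj_diagonal hV]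
  refine Finset.sum_nbij' (fun J => Jᶜ) (fun J => Jᶜ) (by simp) (by simp) (by simp) (by simp) ?_
  intro J _
  rw [← minorSq_compl, compl_compl]

theorem minorSq_nonneg {V : Matrix X X ℝ} (hV : V * V.transpose = 1) (R J : Finset X) :
    0 ≤ minorSq V R J := by
  by_cases hc : R.card = J.card
  swap
  · rw [minorSq_eq_zero V hc]
  -- `minorSq V R J` is a principal minor of the projection on the columns outside `J`
  have h := rowMinor_conj_diagonal hV (fun j => if j ∈ J then 0 else 1) R
  rw [Finset.sum_eq_single J] at h
  · have h1 : (∏ j ∈ Jᶜ, if j ∈ J then (0 : ℝ) else 1) = 1 :=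
      Finset.prod_eq_one fun j hj => by simp [Finset.mem_compl.1 hj]
    rw [h1, one_mul] at h
    rw [← h]
    refine rowMinor_nonneg_of_posSemidef ?_ R
    have := (Matrix.PosSemidef.diagonal (n := X) (R := ℝ)
      (d := fun j => if j ∈ J then 0 else 1)
      (by intro j; by_cases hj : j ∈ J <;> simp [hj])).mul_mul_conjTranspose_same V
    rwa [Matrix.conjTranspose_eq_transpose_of_trivial] at this
  · intro J' _ hJ'
    by_cases hc' : R.card = J'.card
    · obtain ⟨j, hj, hj'⟩ : ∃ j ∈ J, j ∉ J' := by
        by_contra! hsub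
        exact hJ' (Finset.eq_of_subset_of_card_le hsub (by omega)).symm
      rw [Finset.prod_eq_zero (Finset.mem_compl.2 hj') (by simp [hj]), zero_mul]
    · rw [minorSq_eq_zero V hc', mul_zero]
  · simp

end Orthogonal

/-! ### The matrix forest theorem -/

section Parent

variable {X : Type*} [Fintype X] [DecidableEq X]

/-- The edges `(x, r x)`, `x ∉ R`, of the functional graph of `r` cut at `R`. -/
def ParentEdge (R : Finset X) (r : X → X) (a b : X) : Prop := a ∉ R ∧ r a = b

/-- The matrix `1 - N`, where `N` is the adjacency matrix of `ParentEdge R r`. -/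
def parentMatrix (R : Finset X) (r : X → X) : Matrix X X ℝ :=
  Matrix.of fun x y =>
    (1 : Matrix X X ℝ) x y - if x ∈ R then 0 else (1 : Matrix X X ℝ) (r x) y

theorem det_parentMatrix_of_acyclic {R : Finset X} {r : X → X}
    (h : ∀ x, ¬ Relation.TransGen (ParentEdge R r) x x) : (parentMatrix R r).det = 1 := by
  have hr : ∀ x ∉ R, r x ≠ x := fun x hx hxx => h x (.single ⟨hx, hxx⟩)
  rw [Matrix.det_apply, Finset.sum_eq_single 1]
  · rw [Equiv.Perm.sign_one, one_smul]
    refine Finset.prod_eq_one fun x _ => ?_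
    by_cases hx : x ∈ R
    · simp [parentMatrix, hx]
    · simp [parentMatrix, hx, Matrix.one_apply, hr x hx]
  · -- the orbit of a moved point under a permutation with nonzero weight is a cycle
    intro σ _ hσ
    obtain ⟨i, hi⟩ : ∃ i, σ i ≠ i := by
      by_contra! hall
      exact hσ (Equiv.ext hall)
    by_contra hne
    have hprod : ∏ j, parentMatrix R r (σ j) j ≠ 0 := fun h0 => hne (by rw [h0, smul_zero])
    have hedge : ∀ j, σ j ≠ j → ParentEdge R r (σ j) j := by
      intro j hj
      have h1 := Finset.prod_ne_zero_iff.1 hprod j (Finset.mem_univ j)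
      by_contra hE
      apply h1
      simp only [ParentEdge, not_and] at hE
      by_cases hx : σ j ∈ R
      · simp [parentMatrix, hx, Matrix.one_apply, hj]
      · simp [parentMatrix, hx, Matrix.one_apply, hj, hE hx]
    have hmov : ∀ k : ℕ, σ ((σ ^ k) i) ≠ (σ ^ k) i := by
      intro k hk
      rw [← Equiv.Perm.mul_apply, ← pow_succ', pow_succ, Equiv.Perm.mul_apply] at hk
      exact hi ((σ ^ k).injective hk)
    have hpath : ∀ k : ℕ, Relation.TransGen (ParentEdge R r) ((σ ^ (k + 1)) i) i := by
      intro k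
      induction k with
      | zero => simpa using Relation.TransGen.single (hedge i hi)
      | succ k ih =>
        refine Relation.TransGen.head ?_ ih
        rw [pow_succ', Equiv.Perm.mul_apply]
        exact hedge _ (hmov (k + 1))
    have := hpath (orderOf σ - 1)
    rw [Nat.sub_add_cancel (orderOf_pos σ), pow_orderOf_eq_one] at this
    exact h i this
  · simp

theorem det_parentMatrix_of_cyclic {R : Finset X} {r : X → X} {x₀ : X}
    (h : Relation.TransGen (ParentEdge R r) x₀ x₀) : (parentMatrix R r).det = 0 := by
  classical
  -- the indicator of the points from which `R` is not reached lies in the kernel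
  let Exits : X → Prop := fun x => ∃ y ∈ R, Relation.ReflTransGen (ParentEdge R r) x y
  have hR : ∀ x ∈ R, Exits x := fun x hx => ⟨x, hx, .refl⟩
  have hstep : ∀ x ∉ R, (Exits x ↔ Exits (r x)) := by
    intro x hx
    constructor
    · rintro ⟨y, hy, hxy⟩
      rcases Relation.ReflTransGen.cases_head hxy with rfl | ⟨c, ⟨_, rfl⟩, hc⟩
      · exact absurd hy hx
      · exact ⟨y, hy, hc⟩
    · rintro ⟨y, hy, hxy⟩
      exact ⟨y, hy, .head ⟨hx, rfl⟩ hxy⟩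
  have hcyc : ¬ Exits x₀ := by
    rintro ⟨y, hy, hxy⟩
    induction hxy using Relation.ReflTransGen.head_induction_on with
    | refl =>
      obtain ⟨c, hc, _⟩ := Relation.TransGen.head'_iff.1 h
      exact hc.1 hy
    | head hac _ ih =>
      refine ih ?_
      obtain ⟨c', hc', hc'a⟩ := Relation.TransGen.head'_iff.1 h
      obtain rfl : c' = _ := hc'.2.symm.trans hac.2
      exact Relation.TransGen.tail' hc'a hac
  obtain ⟨v, hvR, hv, hv₀⟩ : ∃ v : X → ℝ, (∀ x ∈ R, v x = 0) ∧ (∀ x ∉ R, v x = v (r x)) ∧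
      v x₀ = 1 :=
    ⟨fun x => if Exits x then 0 else 1, fun x hx => if_pos (hR x hx),
      fun x hx => by simp only [hstep x hx], if_neg hcyc⟩
  rw [← Matrix.exists_mulVec_eq_zero_iff]
  refine ⟨v, fun h0 => ?_, ?_⟩
  · simp [h0] at hv₀
  · ext x
    by_cases hx : x ∈ R
    · simp [Matrix.mulVec, dotProduct, parentMatrix, hx, Matrix.one_apply, hvR x hx]
    · simp [Matrix.mulVec, dotProduct, parentMatrix, hx, Matrix.one_apply, sub_mul,
        Finset.sum_sub_distrib, ← hv x hx]

end Parent

theorem mem_roots {X : Type*} [Fintype X] {w : X → X → ℝ≥0} {φ : SpanningForest w} {x : X} :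
    x ∈ roots φ ↔ ∀ y, (x, y) ∉ φ.edges := by
  simp [roots]

/-- The product of the rates along the edges of a forest. -/
def edgeWeight {X : Type*} {w : X → X → ℝ≥0} (φ : SpanningForest w) : ℝ :=
  ∏ e ∈ φ.edges, (w e.1 e.2 : ℝ)

theorem edgeWeight_nonneg {X : Type*} {w : X → X → ℝ≥0} (φ : SpanningForest w) :
    0 ≤ edgeWeight φ :=
  Finset.prod_nonneg fun _ _ => NNReal.coe_nonneg _

section Forest

variable {X : Type*} [Fintype X] [DecidableEq X] {w : X → X → ℝ≥0}

theorem neg_generator_apply (w : X → X → ℝ≥0) (x y : X) :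
    (-generator w) x y =
      ∑ z, (w x z : ℝ) * ((1 : Matrix X X ℝ) x y - (1 : Matrix X X ℝ) z y) := by
  simp only [mul_sub, Finset.sum_sub_distrib]
  have h : ∑ z, (w x z : ℝ) * (1 : Matrix X X ℝ) z y = w x y := by simp [Matrix.one_apply]
  rw [h, ← Finset.sum_mul, ← Finset.add_sum_erase _ _ (Finset.mem_univ x)]
  by_cases hxy : x = y
  · subst hxy; simp [generator, exitRate]
  · simp [generator, hxy]

/-- Expansion of the minor along its rows, by multilinearity: outside `R`, the row `x` of `-L` is
`∑ z, w x z (e_x - e_z)`. -/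
theorem rowMinor_neg_generator (w : X → X → ℝ≥0) (R : Finset X) :
    rowMinor (-generator w) R =
      ∑ r ∈ Fintype.piFinset (fun x => if x ∈ R then {x} else Finset.univ),
        (∏ x ∈ Rᶜ, (w x (r x) : ℝ)) * (parentMatrix R r).det := by
  have h := (Matrix.detRowAlternating (n := X) (R := ℝ)).toMultilinearMap.map_sum_finset
    (fun x z y => if x ∈ R then (1 : Matrix X X ℝ) x y else
      (w x z : ℝ) * ((1 : Matrix X X ℝ) x y - (1 : Matrix X X ℝ) z y))
    (fun x => if x ∈ R then {x} else Finset.univ)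
  refine Eq.trans ?_ (h.trans (Finset.sum_congr rfl fun r _ => ?_))
  · refine congrArg (Matrix.det (n := X) (R := ℝ)) (Matrix.ext fun x y => ?_)
    refine Eq.trans ?_ (Finset.sum_apply (M := fun _ : X => ℝ) y _ _).symm
    by_cases hx : x ∈ R
    · simp [mixRows, hx]
    · simp only [mixRows, hx, if_false, Matrix.of_apply, neg_generator_apply]
  · rw [← det_scaleRows]
    refine congrArg (Matrix.det (n := X) (R := ℝ)) (Matrix.ext fun x y => ?_)
    simp only [Matrix.of_apply, parentMatrix, Finset.mem_compl]
    split_ifs <;> simp_all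

/-- The parent of a vertex in a spanning forest; a root is its own parent. -/
def parent (φ : SpanningForest w) (x : X) : X :=
  open scoped Classical in
  if h : ∃ y, (x, y) ∈ φ.edges then h.choose else x

theorem mem_edges_iff {φ : SpanningForest w} {x y : X} :
    (x, y) ∈ φ.edges ↔ x ∉ roots φ ∧ parent φ x = y := by
  classical
  constructor
  · intro h
    have hex : ∃ y, (x, y) ∈ φ.edges := ⟨y, h⟩
    refine ⟨fun hx => mem_roots.1 hx y h, ?_⟩
    rw [parent, dif_pos hex]
    exact φ.out_unique _ _ _ hex.choose_spec h
  · rintro ⟨h, rfl⟩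
    have hex : ∃ y, (x, y) ∈ φ.edges := by
      by_contra! h0
      exact h (mem_roots.2 h0)
    rw [parent, dif_pos hex]
    exact hex.choose_spec

theorem parent_of_mem_roots {φ : SpanningForest w} {x : X} (h : x ∈ roots φ) :
    parent φ x = x := by
  rw [parent, dif_neg]
  rintro ⟨y, hy⟩
  exact mem_roots.1 h y hy

theorem parentEdge_parent (φ : SpanningForest w) :
    ParentEdge (roots φ) (parent φ) = fun a b => (a, b) ∈ φ.edges := by
  ext a b
  rw [mem_edges_iff, ParentEdge]

theorem edges_eq_image (φ : SpanningForest w) :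
    φ.edges = (roots φ)ᶜ.image fun x => (x, parent φ x) := by
  ext ⟨x, y⟩
  simp [mem_edges_iff]

theorem edgeWeight_eq (φ : SpanningForest w) :
    edgeWeight φ = ∏ x ∈ (roots φ)ᶜ, (w x (parent φ x) : ℝ) := by
  rw [edgeWeight, edges_eq_image, Finset.prod_image]
  intro x _ y _ h
  exact congrArg Prod.fst h

/-- The matrix forest theorem: the forests with root set `R` have total weight the principal minor
of `-L` outside `R`. -/
theorem sum_edgeWeight_roots_eq (w : X → X → ℝ≥0) (R : Finset X) :
    ∑ φ : SpanningForest w with roots φ = R, edgeWeight φ = rowMinor (-generator w) R := by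
  rw [rowMinor_neg_generator]
  refine Finset.sum_of_injOn parent ?_ ?_ ?_ ?_
  · intro φ hφ ψ hψ h
    simp only [Finset.coe_filter, Finset.mem_univ, true_and, Set.mem_ofPred_eq] at hφ hψ
    ext1
    rw [edges_eq_image, edges_eq_image, h, hφ, hψ]
  · intro φ hφ
    simp only [Finset.coe_filter, Finset.mem_univ, true_and, Set.mem_ofPred_eq] at hφ
    subst hφ
    simp only [Finset.mem_coe, Fintype.mem_piFinset]
    intro x
    by_cases hx : x ∈ roots φ <;> simp [hx, parent_of_mem_roots]
  · intro r hr hr'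
    simp only [Fintype.mem_piFinset] at hr
    by_contra hne
    obtain ⟨h1, h2⟩ := mul_ne_zero_iff.1 hne
    have hac : ∀ x, ¬ Relation.TransGen (ParentEdge R r) x x :=
      fun x hx => h2 (det_parentMatrix_of_cyclic hx)
    have hE : ∀ a b, (a, b) ∈ Rᶜ.image (fun x => (x, r x)) ↔ ParentEdge R r a b := by
      intro a b; simp [ParentEdge]
    let φ : SpanningForest w :=
      { edges := Rᶜ.image fun x => (x, r x)
        pos := fun x y hxy => by
          obtain ⟨hx, rfl⟩ := (hE x y).1 hxy
          exact pos_iff_ne_zero.2 fun h0 =>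
            Finset.prod_ne_zero_iff.1 h1 x (by simpa using hx) (by simp [h0])
        out_unique := fun x y z hy hz => ((hE _ _).1 hy).2.symm.trans ((hE _ _).1 hz).2
        acyclic := fun x hx => hac x (by simpa only [hE] using hx) }
    have hφR : roots φ = R := by
      ext x
      rw [mem_roots]
      simp only [φ, hE, ParentEdge]
      constructor
      · intro h; by_contra hx; exact h (r x) ⟨hx, rfl⟩
      · rintro h y ⟨hx, _⟩; exact hx h
    refine hr' ⟨φ, by simpa using hφR, ?_⟩
    ext x
    by_cases hx : x ∈ R
    · rw [parent_of_mem_roots (by rwa [hφR])]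
      have := hr x
      simp only [hx, if_true, Finset.mem_singleton] at this
      exact this.symm
    · exact (mem_edges_iff.1 (show (x, r x) ∈ φ.edges from (hE _ _).2 ⟨hx, rfl⟩)).2
  · intro φ hφ
    simp only [Finset.mem_filter, Finset.mem_univ, true_and] at hφ
    subst hφ
    rw [edgeWeight_eq, det_parentMatrix_of_acyclic, mul_one]
    rw [parentEdge_parent]
    exact φ.acyclic

theorem rowMinor_neg_generator_nonneg (w : X → X → ℝ≥0) (R : Finset X) :
    0 ≤ rowMinor (-generator w) R := by
  rw [← sum_edgeWeight_roots_eq]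
  exact Finset.sum_nonneg fun φ _ => edgeWeight_nonneg φ

theorem sum_forestWeight_mul (w : X → X → ℝ≥0) (q : ℝ) (f : Finset X → ℝ) :
    ∑ φ : SpanningForest w, forestWeight q φ * f (roots φ) =
      ∑ R : Finset X, q ^ R.card * rowMinor (-generator w) R * f R := by
  rw [← Finset.sum_fiberwise Finset.univ roots]
  refine Finset.sum_congr rfl fun R _ => ?_
  rw [← sum_edgeWeight_roots_eq, Finset.mul_sum, Finset.sum_mul]
  refine Finset.sum_congr rfl fun φ hφ => ?_
  rw [← (Finset.mem_filter.1 hφ).2]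
  rfl

theorem det_smul_one_sub_generator (w : X → X → ℝ≥0) (q : ℝ) :
    (q • (1 : Matrix X X ℝ) - generator w).det =
      ∑ R : Finset X, q ^ R.card * rowMinor (-generator w) R := by
  have : q • (1 : Matrix X X ℝ) - generator w = Matrix.diagonal (fun _ => q) + -generator w := by
    rw [sub_eq_add_neg, Matrix.smul_one_eq_diagonal]
  rw [this, det_diagonal_add]
  simp

theorem partitionFunction_eq_det (w : X → X → ℝ≥0) (q : ℝ) :
    partitionFunction w q = (q • (1 : Matrix X X ℝ) - generator w).det := by
  have := sum_forestWeight_mul w q (fun _ => 1)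
  simp only [mul_one] at this
  rw [partitionFunction, this, det_smul_one_sub_generator]

theorem partitionFunction_pos (w : X → X → ℝ≥0) {q : ℝ} (hq : 0 < q) :
    0 < partitionFunction w q := by
  rw [partitionFunction_eq_det, det_smul_one_sub_generator]
  refine Finset.sum_pos' (fun R _ => mul_nonneg (by positivity)
    (rowMinor_neg_generator_nonneg w R)) ⟨Finset.univ, Finset.mem_univ _, ?_⟩
  rw [rowMinor_univ]
  positivity

end Forest

/-! ### Green functions of substochastic matrices -/

section Green

open Filter Topology

variable {Y : Type*} [Fintype Y] [DecidableEq Y] {Q : Matrix Y Y ℝ}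

/-- The survival probabilities `Q ^ k 1` decrease to a fixed vector of `Q`, which vanishes when
`1 - Q` is invertible. -/
theorem tendsto_pow_substochastic (h0 : ∀ i j, 0 ≤ Q i j) (h1 : ∀ i, ∑ j, Q i j ≤ 1)
    (hdet : (1 - Q).det ≠ 0) (i j : Y) : Tendsto (fun k : ℕ => (Q ^ k) i j) atTop (𝓝 0) := by
  have hpow : ∀ k i j, 0 ≤ (Q ^ k) i j := fun k i j => Matrix.pow_apply_nonneg h0 k i j
  let u : ℕ → Y → ℝ := fun k i => ∑ j, (Q ^ k) i j
  have hu0 : ∀ k i, 0 ≤ u k i := fun k i => Finset.sum_nonneg fun j _ => hpow k i j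
  have hanti : ∀ i, Antitone fun k => u k i := by
    refine fun i => antitone_nat_of_succ_le fun k => ?_
    simp only [u, pow_succ, Matrix.mul_apply]
    rw [Finset.sum_comm]
    refine Finset.sum_le_sum fun l _ => ?_
    rw [← Finset.mul_sum]
    exact mul_le_of_le_one_right (hpow k i l) (h1 l)
  have hsucc : ∀ k i, u (k + 1) i = ∑ l, Q i l * u k l := by
    intro k i
    simp only [u, pow_succ', Matrix.mul_apply]
    rw [Finset.sum_comm]
    simp only [Finset.mul_sum]
  have hlim : ∀ i, ∃ v, Tendsto (fun k => u k i) atTop (𝓝 v) := fun i =>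
    ⟨_, tendsto_atTop_ciInf (hanti i) ⟨0, by rintro _ ⟨k, rfl⟩; exact hu0 k i⟩⟩
  choose v hv using hlim
  have hfix : ∀ i, v i = ∑ l, Q i l * v l := fun i =>
    tendsto_nhds_unique ((hv i).comp (tendsto_add_atTop_nat 1))
      (((tendsto_finsetSum _ fun l _ => (hv l).const_mul (Q i l)).congr
        fun k => (hsucc k i).symm))
  have hv0 : v = 0 := by
    refine Matrix.eq_zero_of_mulVec_eq_zero hdet ?_
    rw [Matrix.sub_mulVec, Matrix.one_mulVec, sub_eq_zero]
    ext i
    rw [hfix i]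
    rfl
  refine squeeze_zero (fun k => hpow k i j) (fun k => ?_) (by simpa [hv0] using hv i)
  exact Finset.single_le_sum (f := fun j => (Q ^ k) i j) (fun j _ => hpow k i j) (Finset.mem_univ j)

theorem hasSum_pow_substochastic (h0 : ∀ i j, 0 ≤ Q i j) (h1 : ∀ i, ∑ j, Q i j ≤ 1)
    (hdet : (1 - Q).det ≠ 0) (i j : Y) :
    HasSum (fun k : ℕ => (Q ^ k) i j) ((1 - Q)⁻¹ i j) := by
  rw [hasSum_iff_tendsto_nat_of_nonneg fun k => Matrix.pow_apply_nonneg h0 k i j]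
  have hgeom : ∀ N : ℕ, ∑ k ∈ Finset.range N, (Q ^ k) i j =
      (1 - Q)⁻¹ i j - ∑ l, (1 - Q)⁻¹ i l * (Q ^ N) l j := by
    intro N
    have h2 := mul_neg_geom_sum Q N
    have h3 : ∑ k ∈ Finset.range N, Q ^ k = (1 - Q)⁻¹ - (1 - Q)⁻¹ * Q ^ N := by
      calc ∑ k ∈ Finset.range N, Q ^ k
          = (1 - Q)⁻¹ * ((1 - Q) * ∑ k ∈ Finset.range N, Q ^ k) := by
            rw [← Matrix.mul_assoc, Matrix.nonsing_inv_mul _ (isUnit_iff_ne_zero.2 hdet),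
              Matrix.one_mul]
        _ = _ := by rw [h2, Matrix.mul_sub, Matrix.mul_one]
    have h4 := congrFun (congrFun h3 i) j
    rw [Matrix.sum_apply] at h4
    rw [h4, Matrix.sub_apply, Matrix.mul_apply]
  simp only [hgeom]
  have := tendsto_const_nhds (x := (1 - Q)⁻¹ i j) (f := atTop (α := ℕ)) |>.sub
    (tendsto_finsetSum Finset.univ fun l _ =>
      (tendsto_pow_substochastic h0 h1 hdet l j).const_mul ((1 - Q)⁻¹ i l))
  simpa using this

theorem inv_one_sub_nonneg (h0 : ∀ i j, 0 ≤ Q i j) (h1 : ∀ i, ∑ j, Q i j ≤ 1)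
    (hdet : (1 - Q).det ≠ 0) (i j : Y) : 0 ≤ (1 - Q)⁻¹ i j :=
  (hasSum_pow_substochastic h0 h1 hdet i j).nonneg fun k => Matrix.pow_apply_nonneg h0 k i j

end Green

/-! ### The trace chain -/

/-- The trajectories which are at `y` at time `k` and avoid `R` at the times `1, …, k - 1`. -/
def avoidEvent {X : Type*} (R : Finset X) (k : ℕ) (y : X) : Set (ℕ → X) :=
  {ω | (∀ i, 1 ≤ i → i < k → ω i ∉ R) ∧ ω k = y}

theorem measurableSet_avoidEvent {X : Type*} [MeasurableSpace X] [DiscreteMeasurableSpace X]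
    (R : Finset X) (k : ℕ) (y : X) : MeasurableSet (avoidEvent R k y) := by
  have h : avoidEvent R k y =
      (⋂ i, ⋂ (_ : 1 ≤ i), ⋂ (_ : i < k), (fun ω : ℕ → X => ω i) ⁻¹' {z | z ∉ R}) ∩
        (fun ω : ℕ → X => ω k) ⁻¹' {y} := by
    ext ω; simp [avoidEvent]
  rw [h]
  refine MeasurableSet.inter ?_ (measurable_pi_apply k (.of_discrete))
  exact MeasurableSet.iInter fun i => MeasurableSet.iInter fun _ => MeasurableSet.iInter fun _ =>
    measurable_pi_apply i (.of_discrete)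

section Trace

variable {X : Type*} [Fintype X] [DecidableEq X]

/-- The transition matrix of the skeleton killed when leaving a point of `R`. -/
def killedMatrix (w : X → X → ℝ≥0) (R : Finset X) : Matrix X X ℝ :=
  mixRows R 0 (transitionMatrix w)

theorem killedMatrix_nonneg (w : X → X → ℝ≥0) (R : Finset X) (x y : X) :
    0 ≤ killedMatrix w R x y := by
  by_cases hx : x ∈ R <;> simp [killedMatrix, mixRows, hx, transitionMatrix_nonneg]

theorem sum_killedMatrix_le (w : X → X → ℝ≥0) (R : Finset X) (x : X) :
    ∑ y, killedMatrix w R x y ≤ 1 := by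
  by_cases hx : x ∈ R <;> simp [killedMatrix, mixRows, hx, sum_transitionMatrix]

theorem one_sub_killedMatrix (w : X → X → ℝ≥0) (R : Finset X) :
    1 - killedMatrix w R = mixRows R 1 (1 - transitionMatrix w) := by
  ext x y
  by_cases hx : x ∈ R <;> simp [killedMatrix, mixRows, hx]

variable [MeasurableSpace X] [DiscreteMeasurableSpace X]

instance isProbabilityMeasure_chainLaw (w : X → X → ℝ≥0) (x : X) :
    IsProbabilityMeasure (chainLaw w x) := by
  unfold chainLaw; infer_instance

theorem stepMeasure_singleton (w : X → X → ℝ≥0) (y z : X) :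
    stepMeasure w y {z} = ENNReal.ofReal (transitionMatrix w y z) := by
  simp only [stepMeasure, Measure.coe_finsetSum, Measure.smul_apply, Finset.sum_apply,
    smul_eq_mul]
  rw [Finset.sum_eq_single z]
  · simp
  · intro b _ hb; simp [hb]
  · simp

/-- The one-step Markov property of the skeleton. -/
theorem chainLaw_inter_succ (w : X → X → ℝ≥0) (x : X) (k : ℕ)
    (S : Set ((i : Finset.Iic k) → (fun _ : ℕ => X) i)) (y z : X)
    (hS : ∀ h ∈ S, h ⟨k, Finset.mem_Iic.2 le_rfl⟩ = y) :
    (chainLaw w x).real {ω | Preorder.frestrictLe k ω ∈ S ∧ ω (k + 1) = z} =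
      (chainLaw w x).real {ω | Preorder.frestrictLe (π := fun _ : ℕ => X) k ω ∈ S} *
        transitionMatrix w y z := by
  have hSm : MeasurableSet S := S.toFinite.measurableSet
  have hm : Measurable (Preorder.frestrictLe (π := fun _ : ℕ => X) k) :=
    Preorder.measurable_frestrictLe k
  have h := Kernel.partialTraj_compProd_eq_map_traj (X := fun _ : ℕ => X) (κ := chainStep w)
    (Nat.zero_le k) (x₀ := fun _ => x)
  have h2 := congrArg (fun m => m (S ×ˢ {z})) h
  simp only at h2
  rw [Measure.compProd_apply_prod hSm (measurableSet_singleton z),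
    Measure.map_apply (by fun_prop) (hSm.prod (measurableSet_singleton z)),
    setLIntegral_congr_fun (g := fun _ => ENNReal.ofReal (transitionMatrix w y z)) hSm
      (fun h hh => by
        change stepMeasure w (h ⟨k, Finset.mem_Iic.2 le_rfl⟩) {z} = _
        rw [hS h hh, stepMeasure_singleton]),
    setLIntegral_const, ← Kernel.traj_map_frestrictLe_apply, Measure.map_apply hm hSm] at h2
  have h3 : {ω : ℕ → X | Preorder.frestrictLe (π := fun _ : ℕ => X) k ω ∈ S ∧ ω (k + 1) = z} =
      (fun ω : ℕ → X => (Preorder.frestrictLe (π := fun _ : ℕ => X) k ω, ω (k + 1))) ⁻¹'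
        (S ×ˢ {z}) := by
    ext ω; simp
  rw [Measure.real, Measure.real, h3]
  change (Kernel.traj (X := fun _ : ℕ => X) (chainStep w) 0 (fun _ => x) _).toReal = _
  rw [← h2, ENNReal.toReal_mul, ENNReal.toReal_ofReal (transitionMatrix_nonneg w y z), mul_comm]
  rfl

theorem chainLaw_avoidEvent_one (w : X → X → ℝ≥0) (R : Finset X) (x y : X) :
    (chainLaw w x).real (avoidEvent R 1 y) = transitionMatrix w x y := by
  have h := Kernel.map_traj_succ_self (X := fun _ : ℕ => X) (κ := chainStep w) (a := 0)
  have h2 : (Kernel.traj (X := fun _ : ℕ => X) (chainStep w) 0).map (fun ω => ω (0 + 1))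
      (fun _ => x) {y} = chainStep w 0 (fun _ => x) {y} := by rw [h]
  rw [Kernel.map_apply' _ (by fun_prop) _ (measurableSet_singleton y)] at h2
  have h3 : avoidEvent R 1 y = (fun ω : ℕ → X => ω (0 + 1)) ⁻¹' {y} := by
    ext ω
    simp only [avoidEvent, Set.mem_ofPred_eq, Set.mem_preimage, Set.mem_singleton_iff, zero_add,
      and_iff_right_iff_imp]
    intro _ i hi hi'
    omega
  rw [Measure.real, h3, chainLaw, h2]
  change (stepMeasure w x {y}).toReal = _
  rw [stepMeasure_singleton, ENNReal.toReal_ofReal (transitionMatrix_nonneg w x y)]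

theorem chainLaw_avoidEvent_succ (w : X → X → ℝ≥0) (R : Finset X) (x y : X) {k : ℕ} (hk : 1 ≤ k) :
    (chainLaw w x).real (avoidEvent R (k + 1) y) =
      ∑ z, (chainLaw w x).real (avoidEvent R k z) * killedMatrix w R z y := by
  classical
  have hdec : avoidEvent R (k + 1) y =
      ⋃ z ∈ Rᶜ, {ω | ω ∈ avoidEvent R k z ∧ ω (k + 1) = y} := by
    ext ω
    simp only [avoidEvent, Set.mem_ofPred_eq, Set.mem_iUnion, Finset.mem_compl, exists_prop]
    constructor
    · rintro ⟨h1, h2⟩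
      exact ⟨ω k, h1 k hk (Nat.lt_succ_self k), ⟨fun i hi hik => h1 i hi (by omega), rfl⟩, h2⟩
    · rintro ⟨z, hz, ⟨h1, rfl⟩, h2⟩
      refine ⟨fun i hi hik => ?_, h2⟩
      rcases Nat.lt_succ_iff_lt_or_eq.1 hik with h | rfl
      · exact h1 i hi h
      · exact hz
  rw [hdec, measureReal_biUnion_finset]
  · rw [← Finset.sum_add_sum_compl R, Finset.sum_eq_zero (s := R), zero_add]
    · refine Finset.sum_congr rfl fun z hz => ?_
      let S : Set ((i : Finset.Iic k) → (fun _ : ℕ => X) i) :=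
        {h | (∀ i : Finset.Iic k, 1 ≤ (i : ℕ) → (i : ℕ) < k → h i ∉ R) ∧
          h ⟨k, Finset.mem_Iic.2 le_rfl⟩ = z}
      have hS : ∀ ω : ℕ → X, Preorder.frestrictLe (π := fun _ : ℕ => X) k ω ∈ S ↔
          ω ∈ avoidEvent R k z := by
        intro ω
        simp only [S, avoidEvent, Set.mem_ofPred_eq, Preorder.frestrictLe_apply, Subtype.forall,
          Finset.mem_Iic]
        exact and_congr_left fun _ =>
          ⟨fun h i h1 h2 => h i h2.le h1 h2, fun h i _ h1 h2 => h i h1 h2⟩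
      have := chainLaw_inter_succ w x k S z y (fun h hh => hh.2)
      simp only [hS] at this
      rw [this]
      simp [killedMatrix, mixRows, Finset.mem_compl.1 hz, Set.ofPred_mem_eq]
    · intro z hz
      simp [killedMatrix, mixRows, hz]
  · intro z _ z' _ hzz'
    refine Set.disjoint_left.2 fun ω h1 h2 => hzz' ?_
    exact h1.1.2.symm.trans h2.1.2
  · intro z _
    exact (measurableSet_avoidEvent R k z).inter
      (s₂ := (fun ω : ℕ → X => ω (k + 1)) ⁻¹' {y}) (measurable_pi_apply (k + 1) (.of_discrete))

/-- Before reaching `R` again, the skeleton started from `x` moves first by `P` and then by the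
killed matrix. -/
theorem chainLaw_avoidEvent (w : X → X → ℝ≥0) (R : Finset X) (x y : X) (k : ℕ) :
    (chainLaw w x).real (avoidEvent R (k + 1) y) =
      (transitionMatrix w * killedMatrix w R ^ k) x y := by
  induction k generalizing y with
  | zero => rw [zero_add, chainLaw_avoidEvent_one, pow_zero, Matrix.mul_one]
  | succ k ih =>
    rw [chainLaw_avoidEvent_succ _ _ _ _ (Nat.succ_pos k), pow_succ, ← Matrix.mul_assoc,
      Matrix.mul_apply]
    simp only [ih]

/-- The trace chain is the restriction of `P (1 - Q)⁻¹`, with `Q` the killed matrix: sum over the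
time of the return. -/
theorem traceKernel_eq (w : X → X → ℝ≥0) {R : Finset X} (hR : (1 - killedMatrix w R).det ≠ 0)
    (x y : R) :
    traceKernel w R x y = (transitionMatrix w * (1 - killedMatrix w R)⁻¹) x y := by
  have hset : {ω : ℕ → X | ∃ k : ℕ, IsLeast {i : ℕ | 1 ≤ i ∧ ω i ∈ R} k ∧ ω k = y} =
      ⋃ k : ℕ, avoidEvent R (k + 1) (y : X) := by
    ext ω
    simp only [avoidEvent, Set.mem_ofPred_eq, Set.mem_iUnion]
    constructor
    · rintro ⟨k, ⟨⟨hk, _⟩, hmin⟩, hy⟩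
      refine ⟨k - 1, fun i hi hik hiR => ?_, ?_⟩
      · have := hmin ⟨hi, hiR⟩
        omega
      · rwa [Nat.sub_add_cancel hk]
    · rintro ⟨k, h1, h2⟩
      refine ⟨k + 1, ⟨⟨by omega, h2 ▸ y.2⟩, fun i hi => ?_⟩, h2⟩
      by_contra hlt
      exact h1 i hi.1 (not_le.1 hlt) hi.2
  have hdisj : Pairwise (Function.onFun Disjoint fun k : ℕ => avoidEvent R (k + 1) (y : X)) := by
    intro k l hkl
    refine Set.disjoint_left.2 fun ω h1 h2 => ?_
    rcases lt_or_gt_of_ne hkl with h | h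
    · exact h2.1 (k + 1) (by omega) (by omega) (h1.2 ▸ y.2)
    · exact h1.1 (l + 1) (by omega) (by omega) (h2.2 ▸ y.2)
  have hsum : HasSum (fun k : ℕ => (chainLaw w (x : X)).real (avoidEvent R (k + 1) (y : X)))
      ((chainLaw w (x : X)).real (⋃ k : ℕ, avoidEvent R (k + 1) (y : X))) := by
    rw [Measure.real, measure_iUnion hdisj fun k => measurableSet_avoidEvent R (k + 1) y]
    rw [ENNReal.tsum_toReal_eq fun _ => measure_ne_top _ _]
    refine ENNReal.hasSum_toReal ?_
    rw [← measure_iUnion hdisj fun k => measurableSet_avoidEvent R (k + 1) y]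
    exact measure_ne_top _ _
  have hsum2 : HasSum (fun k : ℕ => (transitionMatrix w * killedMatrix w R ^ k) (x : X) (y : X))
      ((transitionMatrix w * (1 - killedMatrix w R)⁻¹) x y) := by
    simp only [Matrix.mul_apply]
    exact hasSum_sum fun z _ => (hasSum_pow_substochastic (killedMatrix_nonneg w R)
      (sum_killedMatrix_le w R) hR z y).mul_left _
  simp only [chainLaw_avoidEvent] at hsum
  rw [traceKernel, Matrix.of_apply, hset]
  exact hsum.unique hsum2

end Trace

/-! ### Irreducibility and hitting times -/

section Hitting

variable {X : Type*}

/-- A nonempty set which is closed under the transitions of an irreducible matrix is everything. -/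
theorem _root_.Matrix.IsIrreducible.mem_of_closed {P : Matrix X X ℝ} (hP : P.IsIrreducible)
    {S : Set X} {x : X} (hx : x ∈ S) (hS : ∀ y ∈ S, ∀ z, 0 < P y z → z ∈ S) (y : X) : y ∈ S := by
  let _ : Quiver X := P.toQuiver
  obtain ⟨p, -⟩ := hP.connected x y
  induction p with
  | nil => exact hx
  | cons p e ih => exact hS _ ih _ e.down

variable [Fintype X] [DecidableEq X]

theorem one_sub_transitionMatrix (w : X → X → ℝ≥0) :
    1 - transitionMatrix w = (maxRate w : ℝ)⁻¹ • -generator w := by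
  rw [transitionMatrix, smul_neg]
  abel

theorem rowMinor_smul (c : ℝ) (A : Matrix X X ℝ) (R : Finset X) :
    rowMinor (c • A) R = c ^ Rᶜ.card * rowMinor A R := by
  rw [rowMinor, rowMinor, ← Finset.prod_const, ← det_scaleRows]
  congr 1
  ext x y
  by_cases hx : x ∈ R <;> simp [hx, mixRows]

theorem det_one_sub_killedMatrix (w : X → X → ℝ≥0) (R : Finset X) :
    (1 - killedMatrix w R).det = rowMinor (1 - transitionMatrix w) R := by
  rw [one_sub_killedMatrix, rowMinor]

/-- The maximum principle: a function vanishing on a nonempty set `R` and harmonic outside `R` is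
zero. -/
theorem det_one_sub_killedMatrix_ne_zero {w : X → X → ℝ≥0}
    (hirr : (transitionMatrix w).IsIrreducible) {R : Finset X} (hR : R.Nonempty) :
    (1 - killedMatrix w R).det ≠ 0 := by
  intro hdet
  obtain ⟨v, hv, hQv⟩ := Matrix.exists_mulVec_eq_zero_iff.2 hdet
  rw [Matrix.sub_mulVec, Matrix.one_mulVec, sub_eq_zero] at hQv
  have hv1 : ∀ x ∈ R, v x = 0 := fun x hx => by
    rw [hQv]; simp [Matrix.mulVec, dotProduct, killedMatrix, mixRows, hx]
  have hv2 : ∀ x ∉ R, v x = ∑ y, transitionMatrix w x y * v y := fun x hx => by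
    conv_lhs => rw [hQv]
    simp [Matrix.mulVec, dotProduct, killedMatrix, mixRows, hx]
  obtain ⟨r, hr⟩ := hR
  obtain ⟨x, -, hx⟩ := Finset.exists_max_image Finset.univ (fun x => |v x|) ⟨r, Finset.mem_univ r⟩
  have hpos : 0 < |v x| := by
    obtain ⟨z, hz⟩ := Function.ne_iff.1 hv
    exact (abs_pos.2 hz).trans_le (hx z (Finset.mem_univ z))
  have hclosed : ∀ y ∈ {y | |v y| = |v x|}, ∀ z, 0 < transitionMatrix w y z →
      z ∈ {y | |v y| = |v x|} := by
    intro y hy z hz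
    simp only [Set.mem_ofPred_eq] at hy ⊢
    have hyR : y ∉ R := fun h => by simp [hv1 y h] at hy; exact hpos.ne hy
    refine le_antisymm (hx z (Finset.mem_univ z)) ?_
    by_contra! hlt
    have h1 : |v y| ≤ ∑ u, transitionMatrix w y u * |v u| := by
      conv_lhs => rw [hv2 y hyR]
      refine (Finset.abs_sum_le_sum_abs _ _).trans (le_of_eq ?_)
      exact Finset.sum_congr rfl fun u _ => by
        rw [abs_mul, abs_of_nonneg (transitionMatrix_nonneg w y u)]
    have h2 : ∑ u, transitionMatrix w y u * |v u| < ∑ u, transitionMatrix w y u * |v x| :=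
      Finset.sum_lt_sum (fun u _ => mul_le_mul_of_nonneg_left (hx u (Finset.mem_univ u))
        (transitionMatrix_nonneg w y u)) ⟨z, Finset.mem_univ z, mul_lt_mul_of_pos_left hlt hz⟩
    rw [← Finset.sum_mul, sum_transitionMatrix, one_mul] at h2
    linarith
  have := hirr.mem_of_closed (S := {y | |v y| = |v x|}) rfl hclosed r
  simp only [Set.mem_ofPred_eq, hv1 r hr, abs_zero] at this
  exact hpos.ne this

/-- The expected number of steps of the skeleton before reaching `R`. -/
def hitTime (w : X → X → ℝ≥0) (R : Finset X) : X → ℝ :=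
  Matrix.mulVec (1 - killedMatrix w R)⁻¹ fun y => if y ∈ R then 0 else 1

theorem hitTime_equation {w : X → X → ℝ≥0} {R : Finset X}
    (hR : (1 - killedMatrix w R).det ≠ 0) (x : X) :
    hitTime w R x - ∑ y, killedMatrix w R x y * hitTime w R y = if x ∈ R then 0 else 1 := by
  have h : Matrix.mulVec (1 - killedMatrix w R) (hitTime w R) =
      fun y => if y ∈ R then 0 else 1 := by
    rw [hitTime, Matrix.mulVec_mulVec, Matrix.mul_nonsing_inv _ (isUnit_iff_ne_zero.2 hR),
      Matrix.one_mulVec]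
  rw [Matrix.sub_mulVec, Matrix.one_mulVec] at h
  exact congrFun h x

/-- On `R` the drift of the hitting time is its mean after one step, and it is `-1` outside `R`. -/
theorem sum_mem_transition_hitTime {w : X → X → ℝ≥0} {R : Finset X}
    (hR : (1 - killedMatrix w R).det ≠ 0) :
    ∑ x ∈ R, ∑ y, transitionMatrix w x y * hitTime w R y =
      ∑ x, (∑ y, transitionMatrix w x y * hitTime w R y - hitTime w R x) + Rᶜ.card := by
  rw [← Finset.sum_add_sum_compl R (fun x => _ - _), add_assoc]
  have h1 : ∀ x ∈ R, hitTime w R x = 0 := by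
    intro x hx
    have := hitTime_equation hR x
    simpa [hx, killedMatrix, mixRows] using this
  have h2 : ∀ x ∈ Rᶜ, ∑ y, transitionMatrix w x y * hitTime w R y - hitTime w R x = -1 := by
    intro x hx
    have := hitTime_equation hR x
    simp only [killedMatrix, mixRows, Matrix.of_apply, Finset.mem_compl.1 hx, if_false] at this
    linarith
  rw [Finset.sum_congr rfl h2,
    Finset.sum_congr rfl fun x hx => by rw [← sub_zero (∑ y, _), ← h1 x hx]]
  simp

end Hitting

/-! ### The mean hitting time of the roots does not depend on the starting point -/

theorem sum_card_eq_of_polynomial_eq {X : Type*} [Fintype X] {a b : Finset X → ℝ}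
    (h : ∀ s : ℝ, s * ∑ R, s ^ R.card * a R = ∑ R, s ^ R.card * b R) (m : ℕ) :
    ∑ R with R.card = m, a R = ∑ R with R.card = m + 1, b R := by
  have hp : (Polynomial.X * ∑ R : Finset X, Polynomial.C (a R) * Polynomial.X ^ R.card :
      Polynomial ℝ) = ∑ R : Finset X, Polynomial.C (b R) * Polynomial.X ^ R.card := by
    refine Polynomial.funext fun s => ?_
    simp only [Polynomial.eval_mul, Polynomial.eval_X, Polynomial.eval_finsetSum,
      Polynomial.eval_C, Polynomial.eval_pow]
    simpa only [mul_comm] using h s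
  have hc := congrArg (fun p => Polynomial.coeff p (m + 1)) hp
  simp only [Polynomial.coeff_X_mul, Polynomial.finsetSum_coeff, Polynomial.coeff_C_mul_X_pow] at hc
  simpa only [Finset.sum_filter, eq_comm] using hc

section Average

variable {X : Type*} [Fintype X] [DecidableEq X]

/-- For a matrix with zero row sums, the solutions of `A h = 1` outside `R`, `h = 0` on `R`,
weighted by the principal minors, have the same average at every point. -/
theorem sum_cramer_mixRows {A : Matrix X X ℝ} (hA : ∀ x, ∑ y, A x y = 0) (m : ℕ) (x : X) :
    ∑ R with R.card = m, (mixRows R 1 A).cramer (fun y => if y ∈ R then 0 else 1) x =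
      ∑ R with R.card = m + 1, rowMinor A R := by
  refine sum_card_eq_of_polynomial_eq (fun s => ?_) m
  have hdet := det_diagonal_add (fun _ => s) A
  simp only [Finset.prod_const] at hdet
  rw [← hdet]
  -- Cramer's rule for `(s + A) 1 = s 1`
  have h1 : s * ((Matrix.diagonal (fun _ => s) + A).cramer 1 x) =
      (Matrix.diagonal (fun _ => s) + A).det := by
    have h2 : Matrix.mulVec (Matrix.diagonal (fun _ => s) + A) 1 = s • (1 : X → ℝ) := by
      ext y
      simp [Matrix.mulVec, dotProduct, Finset.sum_add_distrib, Matrix.diagonal_apply, hA]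
    have h3 : (Matrix.diagonal (fun _ => s) + A).cramer (s • (1 : X → ℝ)) =
        (Matrix.diagonal (fun _ => s) + A).det • (1 : X → ℝ) := by
      rw [← h2, Matrix.cramer_eq_adjugate_mulVec, Matrix.mulVec_mulVec, Matrix.adjugate_mul,
        Matrix.smul_mulVec, Matrix.one_mulVec]
    have := congrFun h3 x
    simpa using this
  rw [← h1, Matrix.cramer_apply]
  congr 1
  have h4 : (Matrix.diagonal (fun _ => s) + A).updateCol x 1 =
      Matrix.diagonal (fun y => if y = x then 0 else s) + A.updateCol x 1 := by
    ext y z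
    by_cases hz : z = x
    · subst hz
      by_cases hy : y = z
      · subst hy; simp
      · simp [hy]
    · by_cases hy : y = z
      · subst hy; simp [hz]
      · simp [hz, hy]
  rw [h4, det_diagonal_add]
  refine Finset.sum_congr rfl fun R _ => ?_
  rw [Matrix.cramer_apply]
  by_cases hx : x ∈ R
  · rw [Finset.prod_eq_zero hx (by simp), zero_mul, Matrix.det_eq_zero_of_row_eq_zero x, mul_zero]
    intro y
    by_cases hy : y = x
    · subst hy; simp [hx]
    · simp [hy, mixRows, hx, Ne.symm hy]
  · have h5 : ∏ y ∈ R, (if y = x then 0 else s) = s ^ R.card := by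
      rw [← Finset.prod_const]
      exact Finset.prod_congr rfl fun y hy => if_neg fun h : y = x => hx (h ▸ hy)
    rw [h5, rowMinor]
    congr 2
    ext y z
    by_cases hy : y ∈ R
    · have : y ≠ x := fun h => hx (h ▸ hy)
      by_cases hz : z = x
      · subst hz; simp [mixRows, hy, this]
      · simp [mixRows, hy, hz]
    · by_cases hz : z = x
      · subst hz; simp [mixRows, hy]
      · simp [mixRows, hy, hz]

theorem rowMinor_mul_hitTime {w : X → X → ℝ≥0} {R : Finset X}
    (hR : (1 - killedMatrix w R).det ≠ 0) (x : X) :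
    rowMinor (1 - transitionMatrix w) R * hitTime w R x =
      (mixRows R 1 (1 - transitionMatrix w)).cramer (fun y => if y ∈ R then 0 else 1) x := by
  rw [← one_sub_killedMatrix, ← Matrix.det_smul_inv_mulVec_eq_cramer _ _ (isUnit_iff_ne_zero.2 hR),
    det_one_sub_killedMatrix]
  rfl

/-- Averaged over the root sets of cardinality `m`, the hitting time is constant, so that its drift
under `P` vanishes in mean; the drift is `-1` at the `n - m` points outside `R`. -/
theorem sum_rowMinor_mul_transition_hitTime {w : X → X → ℝ≥0}
    (hirr : (transitionMatrix w).IsIrreducible) {m : ℕ} (hm : 1 ≤ m) :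
    ∑ R with R.card = m, rowMinor (1 - transitionMatrix w) R *
        ∑ x ∈ R, ∑ y, transitionMatrix w x y * hitTime w R y =
      ((Fintype.card X : ℝ) - m) * ∑ R with R.card = m, rowMinor (1 - transitionMatrix w) R := by
  have hdet : ∀ R ∈ (Finset.univ.filter fun R : Finset X => R.card = m),
      (1 - killedMatrix w R).det ≠ 0 := by
    intro R hR
    refine det_one_sub_killedMatrix_ne_zero hirr (Finset.card_pos.1 ?_)
    rw [(Finset.mem_filter.1 hR).2]; omega
  have hA : ∀ x, ∑ y, (1 - transitionMatrix w) x y = 0 := by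
    intro x
    simp [Finset.sum_sub_distrib, sum_transitionMatrix, Matrix.one_apply]
  obtain ⟨c, hc⟩ : ∃ c, ∀ x, ∑ R with R.card = m, rowMinor (1 - transitionMatrix w) R *
      hitTime w R x = c := by
    refine ⟨∑ R with R.card = m + 1, rowMinor (1 - transitionMatrix w) R, fun x => ?_⟩
    rw [← sum_cramer_mixRows hA m x]
    exact Finset.sum_congr rfl fun R hR => rowMinor_mul_hitTime (hdet R hR) x
  have h1 : ∀ R ∈ (Finset.univ.filter fun R : Finset X => R.card = m),
      rowMinor (1 - transitionMatrix w) R *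
        ∑ x ∈ R, ∑ y, transitionMatrix w x y * hitTime w R y =
      ∑ x, (∑ y, transitionMatrix w x y *
          (rowMinor (1 - transitionMatrix w) R * hitTime w R y) -
        rowMinor (1 - transitionMatrix w) R * hitTime w R x) +
      ((Fintype.card X : ℝ) - m) * rowMinor (1 - transitionMatrix w) R := by
    intro R hR
    rw [sum_mem_transition_hitTime (hdet R hR), Finset.card_compl,
      Nat.cast_sub (Finset.card_le_univ R), (Finset.mem_filter.1 hR).2, mul_add, Finset.mul_sum]
    congr 1
    · refine Finset.sum_congr rfl fun x _ => ?_
      rw [mul_sub, Finset.mul_sum]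
      congr 1
      exact Finset.sum_congr rfl fun y _ => by ring
    · ring
  rw [Finset.sum_congr rfl h1, Finset.sum_add_distrib, ← Finset.mul_sum, add_eq_right,
    Finset.sum_comm]
  refine Finset.sum_eq_zero fun x _ => ?_
  rw [Finset.sum_sub_distrib, Finset.sum_comm, hc x]
  simp only [← Finset.mul_sum, hc]
  rw [← Finset.sum_mul, sum_transitionMatrix, one_mul, sub_self]

end Average

/-! ### The intertwining error -/

section Error

variable {X : Type*} [Fintype X] [DecidableEq X] {w : X → X → ℝ≥0} {q' : ℝ}

theorem det_smul_one_sub_generator_pos (w : X → X → ℝ≥0) (hq' : 0 < q') :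
    0 < (q' • (1 : Matrix X X ℝ) - generator w).det := by
  rw [← partitionFunction_eq_det]; exact partitionFunction_pos w hq'

theorem resolventKernel_mul (w : X → X → ℝ≥0) (hq' : 0 < q') :
    resolventKernel w q' * (q' • (1 : Matrix X X ℝ) - generator w) = q' • 1 := by
  rw [resolventKernel, Matrix.smul_mul, Matrix.nonsing_inv_mul _
    (isUnit_iff_ne_zero.2 (det_smul_one_sub_generator_pos w hq').ne')]

theorem mul_resolventKernel (w : X → X → ℝ≥0) (hq' : 0 < q') :
    (q' • (1 : Matrix X X ℝ) - generator w) * resolventKernel w q' = q' • 1 := by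
  rw [resolventKernel, Matrix.mul_smul, Matrix.mul_nonsing_inv _
    (isUnit_iff_ne_zero.2 (det_smul_one_sub_generator_pos w hq').ne')]

theorem generator_eq (hα : 0 < maxRate w) :
    generator w = (maxRate w : ℝ) • (transitionMatrix w - 1) := by
  have : (maxRate w : ℝ) ≠ 0 := by exact_mod_cast hα.ne'
  rw [transitionMatrix, add_sub_cancel_right, smul_smul, mul_inv_cancel₀ this, one_smul]

theorem sum_resolventKernel (hα : 0 < maxRate w) (hq' : 0 < q') (x : X) :
    ∑ y, resolventKernel w q' x y = 1 := by
  have h1 : Matrix.mulVec (q' • (1 : Matrix X X ℝ) - generator w) 1 = q' • (1 : X → ℝ) := by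
    rw [generator_eq hα]
    ext y
    simp [Matrix.mulVec, dotProduct, Matrix.one_apply, ← Finset.mul_sum,
      Finset.sum_sub_distrib, sum_transitionMatrix]
  have h2 := congrArg (Matrix.mulVec (resolventKernel w q')) h1
  rw [Matrix.mulVec_mulVec, resolventKernel_mul w hq', Matrix.mulVec_smul, Matrix.smul_mulVec,
    Matrix.one_mulVec] at h2
  have h3 := congrFun h2 x
  simp only [Pi.smul_apply, Pi.one_apply, smul_eq_mul, mul_one, Matrix.mulVec, dotProduct] at h3
  exact (mul_left_cancel₀ hq'.ne' (by rw [mul_one]; exact h3)).symm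

theorem resolventKernel_nonneg (hα : 0 < maxRate w) (hq' : 0 < q') (x y : X) :
    0 ≤ resolventKernel w q' x y := by
  have hα' : 0 < (maxRate w : ℝ) := by exact_mod_cast hα
  have h0 : 0 < q' + maxRate w := by positivity
  let Q : Matrix X X ℝ := ((maxRate w : ℝ) / (q' + maxRate w)) • transitionMatrix w
  have hQ : q' • (1 : Matrix X X ℝ) - generator w = (q' + maxRate w : ℝ) • (1 - Q) := by
    have h1 : (q' + maxRate w) * ((maxRate w : ℝ) / (q' + maxRate w)) = maxRate w := by field_simp
    simp only [generator_eq hα, Q, smul_sub, smul_smul, h1, add_smul]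
    abel
  have hdet : (1 - Q).det ≠ 0 := by
    have := (det_smul_one_sub_generator_pos w hq').ne'
    rw [hQ, Matrix.det_smul] at this
    exact right_ne_zero_of_mul this
  have hK : resolventKernel w q' = (q' / (q' + maxRate w)) • (1 - Q)⁻¹ := by
    rw [resolventKernel, hQ, Matrix.inv_eq_left_inv (B := (q' + maxRate w : ℝ)⁻¹ • (1 - Q)⁻¹),
      smul_smul, div_eq_mul_inv]
    rw [smul_mul_smul_comm, inv_mul_cancel₀ h0.ne', one_smul,
      Matrix.nonsing_inv_mul _ (isUnit_iff_ne_zero.2 hdet)]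
  rw [hK, Matrix.smul_apply, smul_eq_mul]
  refine mul_nonneg (by positivity) (inv_one_sub_nonneg (fun i j => ?_) (fun i => ?_) hdet x y)
  · exact mul_nonneg (by positivity) (transitionMatrix_nonneg w i j)
  · simp only [Q, Matrix.smul_apply, smul_eq_mul]
    rw [← Finset.mul_sum, sum_transitionMatrix, mul_one, div_le_one h0]
    linarith

theorem transitionMatrix_mul_resolventKernel (w : X → X → ℝ≥0) (hq' : 0 < q') :
    transitionMatrix w * resolventKernel w q' = resolventKernel w q' * transitionMatrix w := by
  have h := (mul_resolventKernel w hq').trans (resolventKernel_mul w hq').symm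
  rw [Matrix.sub_mul, Matrix.mul_sub, Matrix.smul_mul, Matrix.mul_smul, Matrix.one_mul,
    Matrix.mul_one, sub_right_inj] at h
  rw [transitionMatrix, Matrix.add_mul, Matrix.mul_add, Matrix.smul_mul, Matrix.mul_smul, h,
    Matrix.one_mul, Matrix.mul_one]

/-- The resolvent equation seen by the skeleton: stopping at rate `q'` outside `R`. -/
theorem one_sub_killedMatrix_mul_resolventKernel (hα : 0 < maxRate w) (hq' : 0 < q')
    (R : Finset X) :
    (1 - killedMatrix w R) * resolventKernel w q' =
      mixRows R (resolventKernel w q') ((q' / maxRate w) • (1 - resolventKernel w q')) := by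
  have hα' : (maxRate w : ℝ) ≠ 0 := by exact_mod_cast hα.ne'
  have h1 : (1 - transitionMatrix w) * resolventKernel w q' =
      (q' / maxRate w) • (1 - resolventKernel w q') := by
    have h := mul_resolventKernel w hq'
    rw [generator_eq hα, Matrix.sub_mul, Matrix.smul_mul, Matrix.one_mul, Matrix.smul_mul,
      sub_eq_iff_eq_add, ← sub_eq_iff_eq_add', ← smul_sub] at h
    have h2 : (transitionMatrix w - 1) * resolventKernel w q' =
        (maxRate w : ℝ)⁻¹ • q' • (resolventKernel w q' - 1) := by
      rw [h, smul_smul, inv_mul_cancel₀ hα', one_smul]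
    rw [← neg_sub (transitionMatrix w), Matrix.neg_mul, h2, smul_smul, ← smul_neg, neg_sub,
      div_eq_inv_mul]
  rw [one_sub_killedMatrix]
  ext x u
  by_cases hx : x ∈ R
  · rw [Matrix.mul_apply]
    simp [mixRows, hx, Matrix.one_apply]
  · have h2 : ∀ A B : Matrix X X ℝ, ∀ y, mixRows R A B x y = B x y := by simp [mixRows, hx]
    rw [h2, ← h1, Matrix.mul_apply, Matrix.mul_apply]
    simp only [h2]

theorem half_sum_abs_one_sub_resolventKernel_le (hα : 0 < maxRate w) (hq' : 0 < q') (x : X) :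
    (1 / 2) * ∑ u, |(1 - resolventKernel w q') x u| ≤ 1 := by
  have h : ∑ u, |(1 - resolventKernel w q') x u| ≤
      ∑ u, ((1 : Matrix X X ℝ) x u + resolventKernel w q' x u) := by
    refine Finset.sum_le_sum fun u _ => ?_
    rw [Matrix.sub_apply]
    refine (abs_sub _ _).trans (le_of_eq ?_)
    rw [abs_of_nonneg (resolventKernel_nonneg hα hq' x u), abs_of_nonneg]
    rw [Matrix.one_apply]; split_ifs <;> norm_num
  rw [Finset.sum_add_distrib, sum_resolventKernel hα hq'] at h
  simp only [Matrix.one_apply, Finset.sum_ite_eq, Finset.mem_univ, if_true] at h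
  linarith

variable [MeasurableSpace X] [DiscreteMeasurableSpace X]

/-- The error is the mean number of steps outside `R` at which the process is stopped. -/
theorem intertwiningError_le (hα : 0 < maxRate w) (hq' : 0 < q') {R : Finset X}
    (hR : (1 - killedMatrix w R).det ≠ 0) :
    intertwiningError w q' R ≤
      q' / maxRate w * ∑ x ∈ R, ∑ y, transitionMatrix w x y * hitTime w R y := by
  have hα' : 0 < (maxRate w : ℝ) := by exact_mod_cast hα
  let G := (1 - killedMatrix w R)⁻¹
  let K := resolventKernel w q'
  let P := transitionMatrix w
  have hPG : ∀ x y, 0 ≤ (P * G) x y := fun x y => by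
    rw [Matrix.mul_apply]
    exact Finset.sum_nonneg fun z _ => mul_nonneg (transitionMatrix_nonneg w x z)
      (inv_one_sub_nonneg (killedMatrix_nonneg w R) (sum_killedMatrix_le w R) hR z y)
  have hPK : P * K = (P * G) * mixRows R K ((q' / maxRate w) • (1 - K)) := by
    rw [← one_sub_killedMatrix_mul_resolventKernel hα hq', Matrix.mul_assoc, ← Matrix.mul_assoc G,
      Matrix.nonsing_inv_mul _ (isUnit_iff_ne_zero.2 hR), Matrix.one_mul]
  have hdiff : ∀ (x : R) (u : X), (linkMatrix w q' R * transitionMatrix w) x u -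
      (traceKernel w R * linkMatrix w q' R) x u =
      ∑ y ∈ Rᶜ, (P * G) x y * (q' / maxRate w * (1 - K) y u) := by
    intro x u
    have h1 : (linkMatrix w q' R * transitionMatrix w) x u = (P * K) x u := by
      rw [transitionMatrix_mul_resolventKernel w hq']
      rfl
    have h2 : (traceKernel w R * linkMatrix w q' R) x u = ∑ y ∈ R, (P * G) x y * K y u := by
      rw [Matrix.mul_apply, ← Finset.sum_coe_sort R]
      exact Finset.sum_congr rfl fun y _ => by rw [traceKernel_eq w hR]; rfl
    rw [h1, h2, hPK, Matrix.mul_apply, ← Finset.sum_add_sum_compl R, sub_eq_iff_eq_add, add_comm]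
    congr 1
    · refine Finset.sum_congr rfl fun y hy => ?_
      simp [mixRows, Finset.mem_compl.1 hy]
    · refine Finset.sum_congr rfl fun y hy => ?_
      simp [mixRows, hy]
  have hrow : ∀ x : R, tvDist ((linkMatrix w q' R * transitionMatrix w) x)
      ((traceKernel w R * linkMatrix w q' R) x) ≤
      q' / maxRate w * ∑ y, transitionMatrix w x y * hitTime w R y := by
    intro x
    have h1 : ∑ y, transitionMatrix w x y * hitTime w R y = ∑ y ∈ Rᶜ, (P * G) x y := by
      change (P.mulVec (hitTime w R)) x = _
      rw [hitTime, Matrix.mulVec_mulVec]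
      simp only [Matrix.mulVec, dotProduct, mul_ite, mul_zero, mul_one]
      rw [← Finset.sum_add_sum_compl R, Finset.sum_eq_zero (s := R), zero_add]
      · exact Finset.sum_congr rfl fun y hy => by rw [if_neg (Finset.mem_compl.1 hy)]
      · intro y hy; rw [if_pos hy]
    rw [tvDist, h1]
    simp only [hdiff]
    calc (1 / 2) * ∑ u, |∑ y ∈ Rᶜ, (P * G) x y * (q' / maxRate w * (1 - K) y u)|
        ≤ (1 / 2) * ∑ u, ∑ y ∈ Rᶜ, (P * G) x y * (q' / maxRate w * |(1 - K) y u|) := by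
          refine mul_le_mul_of_nonneg_left (Finset.sum_le_sum fun u _ => ?_) (by norm_num)
          refine (Finset.abs_sum_le_sum_abs _ _).trans (le_of_eq ?_)
          refine Finset.sum_congr rfl fun y _ => ?_
          rw [abs_mul, abs_mul, abs_of_nonneg (hPG x y), abs_of_nonneg (by positivity)]
      _ = q' / maxRate w * ∑ y ∈ Rᶜ, (P * G) x y * ((1 / 2) * ∑ u, |(1 - K) y u|) := by
          rw [Finset.sum_comm, Finset.mul_sum, Finset.mul_sum]
          refine Finset.sum_congr rfl fun y _ => ?_
          simp only [Finset.mul_sum]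
          exact Finset.sum_congr rfl fun u _ => by ring
      _ ≤ q' / maxRate w * ∑ y ∈ Rᶜ, (P * G) x y := by
          refine mul_le_mul_of_nonneg_left (Finset.sum_le_sum fun y _ => ?_) (by positivity)
          exact mul_le_of_le_one_right (hPG x y)
            (half_sum_abs_one_sub_resolventKernel_le hα hq' y)
  rw [intertwiningError, ← Finset.sum_coe_sort R, Finset.mul_sum]
  exact Finset.sum_le_sum fun x _ => hrow x

theorem sum_rowMinor_mul_intertwiningError_le (hα : 0 < maxRate w)
    (hirr : (transitionMatrix w).IsIrreducible) (hq' : 0 < q') {m : ℕ} (hm : 1 ≤ m) :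
    ∑ R with R.card = m, rowMinor (-generator w) R * intertwiningError w q' R ≤
      q' * ((Fintype.card X : ℝ) - m) / maxRate w *
        ∑ R with R.card = m, rowMinor (-generator w) R := by
  have hα' : 0 < (maxRate w : ℝ) := by exact_mod_cast hα
  have hmem : ∀ R ∈ (Finset.univ.filter fun R : Finset X => R.card = m),
      rowMinor (-generator w) R = (maxRate w : ℝ) ^ (Fintype.card X - m) *
        rowMinor (1 - transitionMatrix w) R := by
    intro R hR
    rw [one_sub_transitionMatrix, rowMinor_smul, Finset.card_compl, (Finset.mem_filter.1 hR).2,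
      ← mul_assoc, ← mul_pow, mul_inv_cancel₀ hα'.ne', one_pow, one_mul]
  calc ∑ R with R.card = m, rowMinor (-generator w) R * intertwiningError w q' R
      ≤ ∑ R with R.card = m, rowMinor (-generator w) R *
          (q' / maxRate w * ∑ x ∈ R, ∑ y, transitionMatrix w x y * hitTime w R y) := by
        refine Finset.sum_le_sum fun R hR => mul_le_mul_of_nonneg_left ?_
          (rowMinor_neg_generator_nonneg w R)
        refine intertwiningError_le hα hq' (det_one_sub_killedMatrix_ne_zero hirr
          (Finset.card_pos.1 ?_))
        rw [(Finset.mem_filter.1 hR).2]; omega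
    _ = (maxRate w : ℝ) ^ (Fintype.card X - m) * (q' / maxRate w) *
          ∑ R with R.card = m, rowMinor (1 - transitionMatrix w) R *
            ∑ x ∈ R, ∑ y, transitionMatrix w x y * hitTime w R y := by
        rw [Finset.mul_sum]
        exact Finset.sum_congr rfl fun R hR => by rw [hmem R hR]; ring
    _ = _ := by
        rw [sum_rowMinor_mul_transition_hitTime hirr hm, Finset.sum_congr rfl hmem,
          ← Finset.mul_sum]
        ring

end Error

/-! ### Spectral decomposition of the generator -/

section Spectral

theorem sum_range_getD (l : List ℝ) (f : ℝ → ℝ) :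
    ∑ j ∈ Finset.range l.length, f (l.getD j 0) = (l.map f).sum := by
  induction l with
  | nil => simp
  | cons a t ih =>
    rw [List.length_cons, Finset.sum_range_succ', List.map_cons, List.sum_cons, ← ih, add_comm]
    simp

theorem getD_zero_of_pairwise_le {l : List ℝ} (hl : l.Pairwise (· ≤ ·)) (h0 : ∀ a ∈ l, 0 ≤ a)
    (hmem : 0 ∈ l) : l.getD 0 0 = 0 := by
  cases l with
  | nil => simp
  | cons a t =>
    rw [List.getD_cons_zero]
    refine le_antisymm ?_ (h0 a (by simp))
    rcases List.mem_cons.1 hmem with h | h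
    · exact h.ge
    · exact (List.pairwise_cons.1 hl).1 0 h

variable {X : Type*} [Fintype X] [DecidableEq X] {w : X → X → ℝ≥0} {μ : X → ℝ}

theorem rate_pos_of_transition_pos {x y : X} (h : 0 < transitionMatrix w x y) (hxy : x ≠ y) :
    0 < w x y := by
  have h1 : transitionMatrix w x y = (maxRate w : ℝ)⁻¹ * w x y := by
    simp [transitionMatrix, generator, hxy]
  rw [h1] at h
  exact_mod_cast pos_of_mul_pos_right h (by positivity)

theorem IsReversible.pos (hμ : IsReversible w μ) (hirr : (transitionMatrix w).IsIrreducible)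
    (x : X) : 0 < μ x := by
  obtain ⟨x₀, hx₀⟩ : ∃ x, 0 < μ x := by
    by_contra! h
    have : ∑ x, μ x ≤ 0 := Finset.sum_nonpos fun x _ => h x
    rw [hμ.sum_eq_one] at this
    norm_num at this
  refine hirr.mem_of_closed (S := {x | 0 < μ x}) hx₀ (fun y hy z hz => ?_) x
  by_cases hyz : y = z
  · exact hyz ▸ hy
  · have h1 : 0 < (w y z : ℝ) := by exact_mod_cast rate_pos_of_transition_pos hz hyz
    have h2 := hμ.detailed_balance y z
    have h3 : 0 < μ z * w z y := h2 ▸ mul_pos hy h1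
    exact pos_of_mul_pos_left h3 (NNReal.coe_nonneg _)

/-- The symmetric matrix `D(√μ) (-L) D(1/√μ)`. -/
def symGenerator (w : X → X → ℝ≥0) (μ : X → ℝ) : Matrix X X ℝ :=
  Matrix.diagonal (fun x => √(μ x)) * -generator w * Matrix.diagonal (fun x => (√(μ x))⁻¹)

theorem symGenerator_apply (x y : X) :
    symGenerator w μ x y = √(μ x) * (-generator w) x y * (√(μ y))⁻¹ := by
  rw [symGenerator, Matrix.mul_diagonal, Matrix.diagonal_mul]

theorem neg_generator_eq_conj (hμ0 : ∀ x, 0 < μ x) :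
    -generator w = Matrix.diagonal (fun x => (√(μ x))⁻¹) * symGenerator w μ *
      Matrix.diagonal (fun x => √(μ x)) := by
  ext x y
  have hx := (Real.sqrt_pos.2 (hμ0 x)).ne'
  have hy := (Real.sqrt_pos.2 (hμ0 y)).ne'
  rw [Matrix.mul_diagonal, Matrix.diagonal_mul, symGenerator_apply]
  field_simp

theorem symGenerator_isHermitian (hμ : IsReversible w μ) (hμ0 : ∀ x, 0 < μ x) :
    (symGenerator w μ).IsHermitian := by
  ext x y
  rw [Matrix.conjTranspose_apply, star_trivial, symGenerator_apply, symGenerator_apply]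
  by_cases hxy : x = y
  · subst hxy; rfl
  · have h1 : (-generator w) x y = -(w x y : ℝ) := by simp [generator, hxy]
    have h2 : (-generator w) y x = -(w y x : ℝ) := by simp [generator, Ne.symm hxy]
    have hx := Real.sqrt_pos.2 (hμ0 x)
    have hy := Real.sqrt_pos.2 (hμ0 y)
    rw [h1, h2, ← div_eq_mul_inv, ← div_eq_mul_inv, div_eq_div_iff hx.ne' hy.ne']
    have := hμ.detailed_balance x y
    rw [← Real.mul_self_sqrt (hμ0 x).le, ← Real.mul_self_sqrt (hμ0 y).le] at this
    linarith

/-- The Dirichlet form of the generator. -/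
theorem sum_mul_neg_generator (hμ : IsReversible w μ) (f : X → ℝ) :
    ∑ x, ∑ y, μ x * f x * (-generator w) x y * f y =
      (1 / 2) * ∑ x, ∑ y, μ x * w x y * (f x - f y) ^ 2 := by
  have h1 : ∀ x, ∑ y, μ x * f x * (-generator w) x y * f y =
      ∑ y, μ x * w x y * (f x * (f x - f y)) := by
    intro x
    simp only [neg_generator_apply, Finset.mul_sum, Finset.sum_mul]
    rw [Finset.sum_comm]
    refine Finset.sum_congr rfl fun z _ => ?_
    simp [Matrix.one_apply, mul_sub, sub_mul, Finset.sum_sub_distrib]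
    ring
  have h2 : ∑ x, ∑ y, μ x * w x y * (f x * (f x - f y)) =
      ∑ x, ∑ y, μ x * w x y * (f y * (f y - f x)) := by
    rw [Finset.sum_comm]
    refine Finset.sum_congr rfl fun x _ => Finset.sum_congr rfl fun y _ => ?_
    rw [hμ.detailed_balance y x]
  have h3 : ∑ x, ∑ y, μ x * w x y * (f x - f y) ^ 2 =
      ∑ x, ∑ y, μ x * w x y * (f x * (f x - f y)) +
        ∑ x, ∑ y, μ x * w x y * (f y * (f y - f x)) := by
    simp only [← Finset.sum_add_distrib]
    exact Finset.sum_congr rfl fun x _ => Finset.sum_congr rfl fun y _ => by ring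
  rw [Finset.sum_congr rfl fun x _ => h1 x, h3, ← h2]
  ring

theorem det_neg_generator (w : X → X → ℝ≥0) [Nonempty X] : (-generator w).det = 0 := by
  refine Matrix.exists_mulVec_eq_zero_iff.1 ⟨1, one_ne_zero, ?_⟩
  ext x
  simp only [Matrix.mulVec, dotProduct, neg_generator_apply, Pi.one_apply, mul_one, Pi.zero_apply]
  rw [Finset.sum_comm]
  simp [Matrix.one_apply, mul_sub, Finset.sum_sub_distrib]

/-- The spectral decomposition of a reversible irreducible generator: the orthonormal eigenbasis `V`
of the symmetrized generator, its eigenvalues `l`, and the index `i₀` of the only zero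
eigenvalue. -/
structure SpectralData (w : X → X → ℝ≥0) (μ : X → ℝ) where
  /-- the orthonormal eigenbasis -/
  V : Matrix X X ℝ
  /-- the eigenvalues -/
  l : X → ℝ
  /-- the index of the eigenvalue zero -/
  i₀ : X
  μ_pos : ∀ x, 0 < μ x
  orth : V * V.transpose = 1
  decomp : symGenerator w μ = V * Matrix.diagonal l * V.transpose
  zero : l i₀ = 0
  pos : ∀ i, i ≠ i₀ → 0 < l i
  sum_Ico : ∀ f : ℝ → ℝ, ∑ j ∈ Finset.Ico 1 (Fintype.card X), f (eigenvalue w j) =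
    ∑ i ∈ Finset.univ.erase i₀, f (l i)

theorem exists_orthogonal_diagonalization {B : Matrix X X ℝ} (hB : B.IsHermitian) :
    ∃ (V : Matrix X X ℝ) (l : X → ℝ), V * V.transpose = 1 ∧
      B = V * Matrix.diagonal l * V.transpose ∧
      B.charpoly.roots = Multiset.map l Finset.univ.val := by
  refine ⟨hB.eigenvectorUnitary, hB.eigenvalues, ?_, ?_, ?_⟩
  · have := Unitary.mul_star_self_of_mem hB.eigenvectorUnitary.2
    rwa [Matrix.star_eq_conjTranspose, Matrix.conjTranspose_eq_transpose_of_trivial] at this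
  · have := hB.spectral_theorem
    rw [Unitary.conjStarAlgAut_apply, Matrix.star_eq_conjTranspose,
      Matrix.conjTranspose_eq_transpose_of_trivial] at this
    exact this
  · exact hB.roots_charpoly_eq_eigenvalues

theorem exists_spectralData (hμ : IsReversible w μ) (hirr : (transitionMatrix w).IsIrreducible) :
    Nonempty (SpectralData w μ) := by
  have hμ0 := hμ.pos hirr
  obtain ⟨V, l, hV, hB, hroots⟩ :=
    exists_orthogonal_diagonalization (symGenerator_isHermitian hμ hμ0)
  have hs : ∀ x, 0 < √(μ x) := fun x => Real.sqrt_pos.2 (hμ0 x)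
  have hX : Nonempty X := by
    by_contra h
    rw [not_nonempty_iff] at h
    have := hμ.sum_eq_one
    simp at this
  have hV' : V.transpose * V = 1 := mul_eq_one_comm.1 hV
  have horth : ∀ i j, ∑ x, V x i * V x j = if i = j then 1 else 0 := by
    intro i j
    have := congrFun (congrFun hV' i) j
    simpa [Matrix.mul_apply, Matrix.one_apply] using this
  -- the eigenvalues are the values of the Dirichlet form on the normalized eigenvectors
  have hdir : ∀ i, l i = (1 / 2) * ∑ x, ∑ y,
      μ x * w x y * (V x i / √(μ x) - V y i / √(μ y)) ^ 2 := by
    intro i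
    rw [← sum_mul_neg_generator hμ]
    have h1 : symGenerator w μ * V = V * Matrix.diagonal l := by
      rw [hB, Matrix.mul_assoc, hV', Matrix.mul_one]
    have h2 : ∀ x, ∑ y, symGenerator w μ x y * V y i = V x i * l i := by
      intro x
      have := congrFun (congrFun h1 x) i
      rwa [Matrix.mul_apply, Matrix.mul_diagonal] at this
    calc l i = ∑ x, V x i * (V x i * l i) := by
          simp only [← mul_assoc, ← Finset.sum_mul, horth, if_true, one_mul]
      _ = _ := by
          refine Finset.sum_congr rfl fun x _ => ?_
          rw [← h2, Finset.mul_sum]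
          refine Finset.sum_congr rfl fun y _ => ?_
          have h3 := (hs x).ne'
          have h4 := (hs y).ne'
          have h5 : μ x * (V x i / √(μ x)) = √(μ x) * V x i := by
            nth_rw 1 [← Real.mul_self_sqrt (hμ0 x).le]
            field_simp
          rw [symGenerator_apply, h5]
          field_simp
  have hterm : ∀ i x y, 0 ≤ μ x * w x y * (V x i / √(μ x) - V y i / √(μ y)) ^ 2 := fun i x y =>
    mul_nonneg (mul_nonneg (hμ0 x).le (NNReal.coe_nonneg _)) (sq_nonneg _)
  have hl0 : ∀ i, 0 ≤ l i := fun i => by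
    rw [hdir]
    exact mul_nonneg (by norm_num)
      (Finset.sum_nonneg fun x _ => Finset.sum_nonneg fun y _ => hterm i x y)
  -- an eigenvector for the eigenvalue zero is proportional to `√μ`
  have hconst : ∀ i, l i = 0 → ∃ c, ∀ x, V x i = c * √(μ x) := by
    intro i hi
    rw [hdir, mul_eq_zero, or_iff_right (by norm_num),
      Finset.sum_eq_zero_iff_of_nonneg fun x _ => Finset.sum_nonneg fun y _ => hterm i x y] at hi
    obtain ⟨x₀⟩ := hX
    refine ⟨V x₀ i / √(μ x₀), fun x => ?_⟩
    have := hirr.mem_of_closed (S := {x | V x i / √(μ x) = V x₀ i / √(μ x₀)}) (x := x₀) rfl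
      (fun y hy z hz => ?_) x
    · simp only [Set.mem_ofPred_eq] at this
      rw [← this, div_mul_cancel₀ _ (hs x).ne']
    · by_cases hyz : y = z
      · exact hyz ▸ hy
      · have h1 := hi y (Finset.mem_univ y)
        rw [Finset.sum_eq_zero_iff_of_nonneg fun z _ => hterm i y z] at h1
        have h2 := h1 z (Finset.mem_univ z)
        have h3 : (w y z : ℝ) ≠ 0 := by exact_mod_cast (rate_pos_of_transition_pos hz hyz).ne'
        simp only [mul_eq_zero, (hμ0 y).ne', h3, false_or, or_false,
          pow_eq_zero_iff two_ne_zero] at h2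
        simp only [Set.mem_ofPred_eq] at hy ⊢
        rw [← hy]; linarith
  obtain ⟨i₀, hi₀⟩ : ∃ i, l i = 0 := by
    have h1 : (symGenerator w μ).det = 0 := by
      rw [symGenerator, Matrix.det_mul, Matrix.det_mul, det_neg_generator]; simp
    have h2 : V.det * V.transpose.det = 1 := by rw [← Matrix.det_mul, hV, Matrix.det_one]
    rw [hB, Matrix.det_mul_right_comm, Matrix.det_mul, Matrix.det_mul, h2, one_mul,
      Matrix.det_diagonal, Finset.prod_eq_zero_iff] at h1
    obtain ⟨i, -, hi⟩ := h1
    exact ⟨i, hi⟩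
  have hpos : ∀ i, i ≠ i₀ → 0 < l i := by
    intro i hne
    refine (hl0 i).lt_of_ne' fun hi => ?_
    obtain ⟨c, hc⟩ := hconst i hi
    obtain ⟨c₀, hc₀⟩ := hconst i₀ hi₀
    have hcc : ∀ a b : ℝ, ∑ x, a * √(μ x) * (b * √(μ x)) = a * b := by
      intro a b
      have : ∀ x, a * √(μ x) * (b * √(μ x)) = a * b * μ x := fun x => by
        nth_rw 3 [← Real.mul_self_sqrt (hμ0 x).le]; ring
      simp only [this, ← Finset.mul_sum, hμ.sum_eq_one, mul_one]
    have h1 := horth i i₀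
    have h2 := horth i i
    have h3 := horth i₀ i₀
    simp only [hc, hc₀, hcc, hne, if_true, if_false] at h1 h2 h3
    rcases mul_eq_zero.1 h1 with h | h <;> simp [h] at h2 h3
  have hsum : ∀ f : ℝ → ℝ, ∑ j ∈ Finset.Ico 1 (Fintype.card X), f (eigenvalue w j) =
      ∑ i ∈ Finset.univ.erase i₀, f (l i) := by
    intro f
    have hrw : (-generator w).charpoly.roots = Multiset.map l Finset.univ.val := by
      rw [← hroots]
      congr 1
      rw [neg_generator_eq_conj (w := w) hμ0, Matrix.charpoly_mul_comm, ← Matrix.mul_assoc,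
        Matrix.diagonal_mul_diagonal]
      simp [(hs _).ne']
    have hlen : (spectrumList w).length = Fintype.card X := by
      rw [spectrumList, Multiset.length_sort, hrw, Multiset.card_map]; rfl
    have hmem : ∀ a, a ∈ spectrumList w ↔ ∃ i, l i = a := by
      intro a
      rw [spectrumList, Multiset.mem_sort, hrw]; simp
    have h0 : eigenvalue w 0 = 0 := by
      refine getD_zero_of_pairwise_le (Multiset.pairwise_sort _ _) (fun a ha => ?_) ?_
      · obtain ⟨i, rfl⟩ := (hmem a).1 ha
        exact hl0 i
      · exact (hmem 0).2 ⟨i₀, hi₀⟩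
    have hall : ∑ j ∈ Finset.range (Fintype.card X), f (eigenvalue w j) = ∑ i, f (l i) := by
      rw [← hlen]
      refine (sum_range_getD (spectrumList w) f).trans ?_
      rw [← Multiset.sum_coe, ← Multiset.map_coe, spectrumList, Multiset.sort_eq, hrw,
        Multiset.map_map]
      rfl
    rw [Finset.sum_Ico_eq_sub _ Fintype.card_pos, hall, Finset.sum_range_one, h0,
      ← Finset.add_sum_erase _ _ (Finset.mem_univ i₀), hi₀, add_sub_cancel_left]
  exact ⟨⟨V, l, i₀, hμ0, hV, hB, hi₀, hpos, hsum⟩⟩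

end Spectral

/-! ### The law of the root set -/

section RootLaw

variable {X : Type*} [Fintype X] [DecidableEq X] {w : X → X → ℝ≥0} {μ : X → ℝ}

theorem pow_card_mul_minorSq (V : Matrix X X ℝ) (y : ℝ) (R J : Finset X) :
    y ^ R.card * minorSq V R J = y ^ J.card * minorSq V R J := by
  by_cases h : R.card = J.card
  · rw [h]
  · rw [minorSq_eq_zero V h, mul_zero, mul_zero]

theorem sum_sum_minorSq {V : Matrix X X ℝ} (hV : V * V.transpose = 1) (c : Finset X → ℝ) :
    ∑ R, ∑ J, c J * minorSq V R J = ∑ J, c J := by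
  rw [Finset.sum_comm]
  refine Finset.sum_congr rfl fun J _ => ?_
  rw [← Finset.mul_sum, sum_minorSq hV, mul_one]

/-- A mixture of determinantal processes has, at every fixed cardinality, at most the mass given by
its generating function. -/
theorem sum_card_mixture_le {V : Matrix X X ℝ} (hV : V * V.transpose = 1) {a b : X → ℝ}
    (ha : ∀ i, 0 ≤ a i) (hb : ∀ i, 0 ≤ b i) {y : ℝ} (hy : 0 ≤ y) (k : ℕ) :
    (∑ R with R.card = k, ∑ J, ((∏ j ∈ J, a j) * ∏ j ∈ Jᶜ, b j) * minorSq V R J) * y ^ k ≤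
      ∏ i, (a i * y + b i) := by
  have h1 : ∏ i, (a i * y + b i) = ∑ J : Finset X, (∏ j ∈ J, a j * y) * ∏ j ∈ Jᶜ, b j := by
    rw [Finset.prod_add, Finset.powerset_univ]
    simp only [Finset.compl_eq_univ_sdiff]
  rw [h1, ← sum_sum_minorSq hV, Finset.sum_mul]
  refine (Finset.sum_le_sum_of_subset_of_nonneg (Finset.filter_subset (fun R => R.card = k) _)
    fun R _ _ => ?_).trans' (Finset.sum_le_sum fun R hR => le_of_eq ?_)
  · exact Finset.sum_nonneg fun J _ => mul_nonneg (mul_nonneg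
      (Finset.prod_nonneg fun j _ => mul_nonneg (ha j) hy) (Finset.prod_nonneg fun j _ => hb j))
      (minorSq_nonneg hV R J)
  · rw [Finset.sum_mul]
    refine Finset.sum_congr rfl fun J _ => ?_
    rw [← (Finset.mem_filter.1 hR).2, Finset.prod_mul_distrib, Finset.prod_const]
    calc _ = ((∏ j ∈ J, a j) * ∏ j ∈ Jᶜ, b j) * (y ^ R.card * minorSq V R J) := by ring
      _ = _ := by rw [pow_card_mul_minorSq]; ring

/-- The probability that the root set of the random forest is `R`. -/
def rootWeight (w : X → X → ℝ≥0) (q : ℝ) (R : Finset X) : ℝ :=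
  q ^ R.card * rowMinor (-generator w) R / partitionFunction w q

theorem rootWeight_nonneg (w : X → X → ℝ≥0) {q : ℝ} (hq : 0 < q) (R : Finset X) :
    0 ≤ rootWeight w q R :=
  div_nonneg (mul_nonneg (by positivity) (rowMinor_neg_generator_nonneg w R))
    (partitionFunction_pos w hq).le

namespace SpectralData

variable (D : SpectralData w μ)

/-- `p_i = q / (q + λ_i)`. -/
def p (q : ℝ) (i : X) : ℝ := q / (q + D.l i)

theorem l_nonneg (i : X) : 0 ≤ D.l i := by
  by_cases h : i = D.i₀
  · rw [h, D.zero]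
  · exact (D.pos i h).le

theorem p_pos {q : ℝ} (hq : 0 < q) (i : X) : 0 < D.p q i :=
  div_pos hq (add_pos_of_pos_of_nonneg hq (D.l_nonneg i))

theorem one_sub_p {q : ℝ} (hq : 0 < q) (i : X) : 1 - D.p q i = D.l i / (q + D.l i) := by
  have := D.l_nonneg i
  rw [p]; field_simp; ring

theorem p_zero {q : ℝ} (hq : 0 < q) : D.p q D.i₀ = 1 := by
  rw [p, D.zero, add_zero, div_self hq.ne']

theorem rowMinor_neg_generator_eq (R : Finset X) :
    rowMinor (-generator w) R = ∑ J, (∏ j ∈ Jᶜ, D.l j) * minorSq D.V R J := by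
  rw [neg_generator_eq_conj D.μ_pos,
    rowMinor_diagonal_conj _ _ _ fun x => (Real.sqrt_pos.2 (D.μ_pos x)).ne', D.decomp,
    rowMinor_conj_diagonal D.orth]

theorem partitionFunction_eq (q : ℝ) : partitionFunction w q = ∏ i, (q + D.l i) := by
  rw [partitionFunction_eq_det, det_smul_one_sub_generator, Finset.prod_add, Finset.powerset_univ]
  simp only [← Finset.compl_eq_univ_sdiff]
  rw [← sum_sum_minorSq D.orth fun J => (∏ _i ∈ J, q) * ∏ i ∈ Jᶜ, D.l i]
  refine Finset.sum_congr rfl fun R _ => ?_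
  rw [D.rowMinor_neg_generator_eq, Finset.mul_sum]
  refine Finset.sum_congr rfl fun J _ => ?_
  rw [mul_left_comm, pow_card_mul_minorSq, Finset.prod_const]
  ring

/-- The root set is a determinantal process: it is obtained by choosing the eigenvector `i` with
probability `p_i`, independently, and then sampling the projection process on these vectors. -/
theorem rootWeight_eq {q : ℝ} (hq : 0 < q) (R : Finset X) :
    rootWeight w q R =
      ∑ J, ((∏ j ∈ J, D.p q j) * ∏ j ∈ Jᶜ, (1 - D.p q j)) * minorSq D.V R J := by
  rw [rootWeight, D.rowMinor_neg_generator_eq, D.partitionFunction_eq, Finset.mul_sum,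
    Finset.sum_div]
  refine Finset.sum_congr rfl fun J _ => ?_
  rw [mul_left_comm, pow_card_mul_minorSq, ← Finset.prod_mul_prod_compl J (fun i => q + D.l i)]
  simp only [D.one_sub_p hq]
  simp only [p, Finset.prod_div_distrib, Finset.prod_const]
  rw [div_mul_div_comm]
  ring

/-- The expected number of non-roots. -/
theorem sum_rootWeight_mul {q : ℝ} (hq : 0 < q) :
    ∑ R, rootWeight w q R * ((Fintype.card X : ℝ) - R.card) =
      ∑ i ∈ Finset.univ.erase D.i₀, D.l i / (q + D.l i) := by
  have h1 : ∀ R, rootWeight w q R * ((Fintype.card X : ℝ) - R.card) =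
      ∑ J, ((∏ j ∈ J, D.p q j) * (∏ j ∈ Jᶜ, (1 - D.p q j)) * (Jᶜ.card : ℝ)) *
        minorSq D.V R J := by
    intro R
    rw [D.rootWeight_eq hq, Finset.sum_mul]
    refine Finset.sum_congr rfl fun J _ => ?_
    by_cases h : R.card = J.card
    · rw [h, Finset.card_compl, Nat.cast_sub (Finset.card_le_univ J)]; ring
    · rw [minorSq_eq_zero _ h]; ring
  have h2 : ∀ i, ∑ J : Finset X, (∏ j ∈ J, D.p q j) * (∏ j ∈ Jᶜ, (1 - D.p q j)) *
      (if i ∈ J then 0 else 1) = 1 - D.p q i := by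
    intro i
    -- the product formula with `p_i` replaced by `0`
    have h3 := Finset.prod_add (fun j => if j = i then 0 else D.p q j) (fun j => 1 - D.p q j)
      Finset.univ
    rw [Finset.powerset_univ] at h3
    rw [Finset.prod_eq_single i (fun j _ hj => by simp [hj]) (by simp)] at h3
    simp only [if_true, zero_add] at h3
    rw [h3]
    refine Finset.sum_congr rfl fun J _ => ?_
    rw [← Finset.compl_eq_univ_sdiff]
    by_cases hi : i ∈ J
    · rw [if_pos hi, mul_zero, Finset.prod_eq_zero hi (by simp), zero_mul]
    · rw [if_neg hi, mul_one]
      congr 1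
      exact Finset.prod_congr rfl fun j hj => (if_neg fun h : j = i => hi (h ▸ hj)).symm
  simp only [h1]
  rw [sum_sum_minorSq D.orth]
  have h4 : ∀ J : Finset X, (Jᶜ.card : ℝ) = ∑ i, if i ∈ J then 0 else 1 := by
    intro J
    rw [Finset.card_eq_sum_ones, Nat.cast_sum, ← Finset.sum_add_sum_compl J,
      Finset.sum_eq_zero fun i hi => if_pos hi, zero_add]
    exact Finset.sum_congr rfl fun i hi => by rw [if_neg (Finset.mem_compl.1 hi)]; simp
  simp only [h4, Finset.mul_sum]
  rw [Finset.sum_comm]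
  simp only [h2]
  simp only [D.one_sub_p hq]
  rw [← Finset.add_sum_erase _ _ (Finset.mem_univ D.i₀), D.zero, zero_div, zero_add]

end SpectralData

end RootLaw

/-! ### Squeezing -/

section Squeezing

variable {X : Type*} [Fintype X] [DecidableEq X]

theorem det_submatrix_mul_inv_apply (N : Matrix X X ℝ) (R : Finset X) (x : R)
    (hN : rowMinor N Rᶜ ≠ 0) :
    rowMinor N Rᶜ * (N.submatrix (Subtype.val : R → X) (Subtype.val : R → X))⁻¹ x x =
      rowMinor N (R.erase x)ᶜ := by
  rw [rowMinor_compl] at hN ⊢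
  rw [Matrix.inv_def, Matrix.smul_apply, smul_eq_mul, Ring.inverse_eq_inv', ← mul_assoc,
    mul_inv_cancel₀ hN, one_mul, Matrix.adjugate_apply]
  have h1 : (N.submatrix (Subtype.val : R → X) (Subtype.val : R → X)).updateRow x (Pi.single x 1) =
      (N.updateRow (x : X) (Pi.single (x : X) 1)).submatrix (Subtype.val : R → X)
        (Subtype.val : R → X) := by
    ext i j
    by_cases hi : i = x
    · subst hi
      rw [Matrix.submatrix_apply, Matrix.updateRow_self, Matrix.updateRow_self]
      simp only [Pi.single_apply, Subtype.ext_iff]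
    · have : (i : X) ≠ x := fun h => hi (Subtype.ext h)
      simp [hi, this]
  rw [h1, ← rowMinor_compl, rowMinor, rowMinor]
  congr 1
  ext i j
  by_cases hi : i = x
  · subst hi; simp [mixRows, Matrix.one_apply, Pi.single_apply, eq_comm]
  · by_cases hR : i ∈ R <;> simp [mixRows, hi, hR]

variable {w : X → X → ℝ≥0} {μ : X → ℝ}

namespace SpectralData

variable (D : SpectralData w μ)

/-- The square of the symmetrized kernel `K_{q'}`. -/
def kernelSq (q' : ℝ) : Matrix X X ℝ :=
  D.V * Matrix.diagonal (fun i => D.p q' i ^ 2) * D.V.transpose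

theorem rowMinor_kernelSq (q' : ℝ) (R : Finset X) :
    rowMinor (D.kernelSq q') Rᶜ = ∑ J, (∏ j ∈ J, D.p q' j ^ 2) * minorSq D.V R J :=
  rowMinor_compl_conj_diagonal D.orth _ R

theorem rowMinor_kernelSq_nonneg (q' : ℝ) (R : Finset X) :
    0 ≤ rowMinor (D.kernelSq q') Rᶜ := by
  rw [rowMinor_kernelSq]
  exact Finset.sum_nonneg fun J _ => mul_nonneg (Finset.prod_nonneg fun j _ => sq_nonneg _)
    (minorSq_nonneg D.orth R J)

theorem resolventKernel_eq {q' : ℝ} (hq' : 0 < q') :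
    resolventKernel w q' = Matrix.diagonal (fun x => (√(μ x))⁻¹) *
      (D.V * Matrix.diagonal (D.p q') * D.V.transpose) * Matrix.diagonal (fun x => √(μ x)) := by
  have hV' : D.V.transpose * D.V = 1 := mul_eq_one_comm.1 D.orth
  have hs : ∀ x, √(μ x) ≠ 0 := fun x => (Real.sqrt_pos.2 (D.μ_pos x)).ne'
  have hE : Matrix.diagonal (fun x => √(μ x)) * Matrix.diagonal (fun x => (√(μ x))⁻¹) = 1 := by
    rw [Matrix.diagonal_mul_diagonal]; simp [hs]
  have hE' : Matrix.diagonal (fun x => (√(μ x))⁻¹) * Matrix.diagonal (fun x => √(μ x)) = 1 := by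
    rw [Matrix.diagonal_mul_diagonal]; simp [hs]
  have hG : q' • (1 : Matrix X X ℝ) - generator w = Matrix.diagonal (fun x => (√(μ x))⁻¹) *
      (D.V * Matrix.diagonal (fun i => q' + D.l i) * D.V.transpose) *
        Matrix.diagonal (fun x => √(μ x)) := by
    have h1 : Matrix.diagonal (fun i => q' + D.l i) = q' • (1 : Matrix X X ℝ) +
        Matrix.diagonal D.l := by
      rw [Matrix.smul_one_eq_diagonal, Matrix.diagonal_add]
    rw [h1, Matrix.mul_add, Matrix.add_mul, ← D.decomp, Matrix.mul_add, Matrix.add_mul,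
      ← neg_generator_eq_conj D.μ_pos, Matrix.mul_smul, Matrix.mul_one, Matrix.smul_mul, D.orth,
      Matrix.mul_smul, Matrix.mul_one, Matrix.smul_mul, hE', sub_eq_add_neg]
  have hpd : Matrix.diagonal (D.p q') * Matrix.diagonal (fun i => q' + D.l i) =
      q' • (1 : Matrix X X ℝ) := by
    rw [Matrix.diagonal_mul_diagonal, Matrix.smul_one_eq_diagonal]
    congr 1
    ext i
    have := D.l_nonneg i
    rw [p, div_mul_cancel₀ _ (by positivity)]
  have hY : (Matrix.diagonal (fun x => (√(μ x))⁻¹) *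
      (D.V * Matrix.diagonal (D.p q') * D.V.transpose) * Matrix.diagonal (fun x => √(μ x))) *
      (q' • (1 : Matrix X X ℝ) - generator w) = q' • 1 := by
    rw [hG]
    calc _ = Matrix.diagonal (fun x => (√(μ x))⁻¹) * (D.V * (Matrix.diagonal (D.p q') *
          (D.V.transpose * ((Matrix.diagonal (fun x => √(μ x)) *
            Matrix.diagonal (fun x => (√(μ x))⁻¹)) * D.V)) *
          Matrix.diagonal (fun i => q' + D.l i)) * D.V.transpose) *
          Matrix.diagonal (fun x => √(μ x)) := by simp only [Matrix.mul_assoc]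
      _ = _ := by
        rw [hE, Matrix.one_mul, hV', Matrix.mul_one, hpd, Matrix.mul_smul, Matrix.mul_one,
          Matrix.smul_mul, D.orth, Matrix.mul_smul, Matrix.mul_one, Matrix.smul_mul, hE']
  have h2 := congrArg (· * resolventKernel w q') hY
  rw [Matrix.mul_assoc, mul_resolventKernel w hq', Matrix.mul_smul, Matrix.mul_one,
    Matrix.smul_mul, Matrix.one_mul] at h2
  exact (smul_right_injective _ hq'.ne' h2).symm

theorem gramMatrix_eq {q' : ℝ} (hq' : 0 < q') (R : Finset X) :
    gramMatrix μ (linkMatrix w q' R) =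
      Matrix.diagonal (fun x : R => (√(μ x))⁻¹) *
        (D.kernelSq q').submatrix (Subtype.val : R → X) (Subtype.val : R → X) *
        Matrix.diagonal (fun x : R => (√(μ x))⁻¹) := by
  have hV' : D.V.transpose * D.V = 1 := mul_eq_one_comm.1 D.orth
  have hsq : D.kernelSq q' = (D.V * Matrix.diagonal (D.p q') * D.V.transpose) *
      (D.V * Matrix.diagonal (D.p q') * D.V.transpose).transpose := by
    rw [Matrix.transpose_mul, Matrix.transpose_mul, Matrix.transpose_transpose,
      Matrix.diagonal_transpose, kernelSq]
    calc _ = D.V * (Matrix.diagonal (D.p q') * Matrix.diagonal (D.p q')) * D.V.transpose := by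
          rw [Matrix.diagonal_mul_diagonal]; simp only [sq]
      _ = D.V * (Matrix.diagonal (D.p q') * (D.V.transpose * D.V) * Matrix.diagonal (D.p q')) *
            D.V.transpose := by rw [hV', Matrix.mul_one]
      _ = _ := by simp only [Matrix.mul_assoc]
  ext x y
  rw [Matrix.mul_diagonal, Matrix.diagonal_mul, Matrix.submatrix_apply, hsq, Matrix.mul_apply,
    gramMatrix, Matrix.mul_apply, Finset.mul_sum, Finset.sum_mul]
  refine Finset.sum_congr rfl fun u _ => ?_
  have h1 := D.μ_pos u
  have h2 : ∀ z : R, linkMatrix w q' R z u = (√(μ z))⁻¹ *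
      (D.V * Matrix.diagonal (D.p q') * D.V.transpose) z u * √(μ u) := by
    intro z
    rw [linkMatrix, Matrix.of_apply, D.resolventKernel_eq hq', Matrix.mul_diagonal,
      Matrix.diagonal_mul]
  rw [Matrix.mul_diagonal, Matrix.transpose_apply, Matrix.transpose_apply, h2, h2]
  calc _ = (√(μ x))⁻¹ * (D.V * Matrix.diagonal (D.p q') * D.V.transpose) x u *
        (D.V * Matrix.diagonal (D.p q') * D.V.transpose) y u * (√(μ y))⁻¹ *
        (√(μ u) * √(μ u) / μ u) := by ring
    _ = _ := by rw [Real.mul_self_sqrt h1.le, div_self h1.ne']; ring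

/-- The numerator of `Trace(Γ⁻¹)`, for the Gram matrix `Γ` of the rows in `R`, over the common
denominator `det (kernelSq)_R`. -/
def traceNumerator (q' : ℝ) (R : Finset X) : ℝ :=
  ∑ x ∈ R, μ x * rowMinor (D.kernelSq q') (R.erase x)ᶜ

theorem traceNumerator_nonneg (q' : ℝ) (R : Finset X) : 0 ≤ D.traceNumerator q' R :=
  Finset.sum_nonneg fun x _ => mul_nonneg (D.μ_pos x).le (D.rowMinor_kernelSq_nonneg q' _)

/-- The diagonal entries of `Γ⁻¹` are ratios of principal minors of the squared kernel. -/
theorem squeezing_eq {q' : ℝ} (hq' : 0 < q') {R : Finset X}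
    (hR : rowMinor (D.kernelSq q') Rᶜ ≠ 0) :
    squeezing μ (linkMatrix w q' R) =
      ENNReal.ofReal √(D.traceNumerator q' R / rowMinor (D.kernelSq q') Rᶜ) := by
  have hs : ∀ x : R, √(μ x) ≠ 0 := fun x => (Real.sqrt_pos.2 (D.μ_pos x)).ne'
  have hdet := hR
  rw [rowMinor_compl] at hdet
  have hΓ := D.gramMatrix_eq hq' R
  have hne : (gramMatrix μ (linkMatrix w q' R)).det ≠ 0 := by
    rw [hΓ, Matrix.det_mul, Matrix.det_mul, Matrix.det_diagonal]
    have : ∏ x : R, (√(μ x))⁻¹ ≠ 0 := Finset.prod_ne_zero_iff.2 fun x _ => inv_ne_zero (hs x)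
    exact mul_ne_zero (mul_ne_zero this hdet) this
  have hinv : (gramMatrix μ (linkMatrix w q' R))⁻¹ = Matrix.diagonal (fun x : R => √(μ x)) *
      ((D.kernelSq q').submatrix (Subtype.val : R → X) (Subtype.val : R → X))⁻¹ *
        Matrix.diagonal (fun x : R => √(μ x)) := by
    have hd : (Matrix.diagonal (fun x : R => (√(μ x))⁻¹))⁻¹ =
        Matrix.diagonal (fun x : R => √(μ x)) := by
      refine Matrix.inv_eq_right_inv ?_
      rw [Matrix.diagonal_mul_diagonal]; simp [hs]
    rw [hΓ, Matrix.mul_inv_rev, Matrix.mul_inv_rev, hd, Matrix.mul_assoc]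
  rw [squeezing, if_neg hne, hinv]
  congr 2
  rw [eq_div_iff hR, traceNumerator, Matrix.trace, Finset.sum_mul, ← Finset.sum_coe_sort R]
  refine Finset.sum_congr rfl fun x _ => ?_
  rw [← det_submatrix_mul_inv_apply _ _ x hR, Matrix.diag_apply, Matrix.mul_diagonal,
    Matrix.diagonal_mul]
  nth_rw 3 [← Real.mul_self_sqrt (D.μ_pos x).le]
  ring

/-- The factor complementary to the Gram determinant in the Cauchy–Schwarz bound of the law of the
root set. -/
def dualWeight (q q' : ℝ) (R : Finset X) : ℝ :=
  ∑ J, ((∏ j ∈ J, D.p q j ^ 2 / D.p q' j ^ 2) * ∏ j ∈ Jᶜ, (1 - D.p q j) ^ 2) * minorSq D.V R J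

theorem dualWeight_nonneg (q q' : ℝ) (R : Finset X) : 0 ≤ D.dualWeight q q' R :=
  Finset.sum_nonneg fun J _ => mul_nonneg (mul_nonneg
    (Finset.prod_nonneg fun j _ => by positivity) (Finset.prod_nonneg fun j _ => by positivity))
    (minorSq_nonneg D.orth R J)

/-- The Cauchy–Schwarz inequality for the expansions in the squared minors `minorSq D.V R J`: each
`∏_J p ∏_{Jᶜ} (1 - p)` is the geometric mean of `∏_J p'²` and `∏_J (p² / p'²) ∏_{Jᶜ} (1 - p)²`. -/
theorem rootWeight_sq_le {q q' : ℝ} (hq : 0 < q) (hq' : 0 < q') (R : Finset X) :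
    rootWeight w q R ^ 2 ≤ rowMinor (D.kernelSq q') Rᶜ * D.dualWeight q q' R := by
  rw [D.rootWeight_eq hq, rowMinor_kernelSq, dualWeight]
  refine Finset.sum_sq_le_sum_mul_sum_of_sq_le_mul _ (fun J _ => ?_) (fun J _ => ?_)
    (fun J _ => le_of_eq ?_)
  · exact mul_nonneg (Finset.prod_nonneg fun j _ => sq_nonneg _) (minorSq_nonneg D.orth R J)
  · exact mul_nonneg (mul_nonneg (Finset.prod_nonneg fun j _ => by positivity)
      (Finset.prod_nonneg fun j _ => by positivity)) (minorSq_nonneg D.orth R J)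
  · have h : ∏ j ∈ J, D.p q' j ^ 2 ≠ 0 :=
      Finset.prod_ne_zero_iff.2 fun j _ => pow_ne_zero _ (D.p_pos hq' j).ne'
    rw [Finset.prod_div_distrib, mul_pow, mul_pow, ← Finset.prod_pow, ← Finset.prod_pow]
    field_simp

theorem rootWeight_mul_sqrt_le {q q' : ℝ} (hq : 0 < q) (hq' : 0 < q') (R : Finset X)
    (hR : rowMinor (D.kernelSq q') Rᶜ ≠ 0) :
    rootWeight w q R * √(D.traceNumerator q' R / rowMinor (D.kernelSq q') Rᶜ) ≤
      √(D.dualWeight q q' R) * √(D.traceNumerator q' R) := by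
  have hd := (D.rowMinor_kernelSq_nonneg q' R).lt_of_ne' hR
  have ht := D.traceNumerator_nonneg q' R
  rw [← Real.sqrt_mul (D.dualWeight_nonneg q q' R)]
  refine Real.le_sqrt_of_sq_le ?_
  rw [mul_pow, Real.sq_sqrt (div_nonneg ht hd.le)]
  calc rootWeight w q R ^ 2 * (D.traceNumerator q' R / rowMinor (D.kernelSq q') Rᶜ)
      ≤ (rowMinor (D.kernelSq q') Rᶜ * D.dualWeight q q' R) *
          (D.traceNumerator q' R / rowMinor (D.kernelSq q') Rᶜ) :=
        mul_le_mul_of_nonneg_right (D.rootWeight_sq_le hq hq' R) (div_nonneg ht hd.le)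
    _ = _ := by field_simp

/-- Removing `x` is injective on the sets containing `x`, and `μ` has total mass one. -/
theorem sum_traceNumerator_le (hμ : ∑ x, μ x = 1) (q' : ℝ) (k : ℕ) :
    ∑ R with R.card = k + 1, D.traceNumerator q' R ≤
      ∑ R with R.card = k, rowMinor (D.kernelSq q') Rᶜ := by
  have h1 : ∀ R : Finset X, D.traceNumerator q' R =
      ∑ x, if x ∈ R then μ x * rowMinor (D.kernelSq q') (R.erase x)ᶜ else 0 := by
    intro R
    rw [traceNumerator, Finset.sum_ite_mem, Finset.univ_inter]
  simp only [h1]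
  rw [Finset.sum_comm, ← one_mul (∑ R with R.card = k, rowMinor (D.kernelSq q') Rᶜ), ← hμ,
    Finset.sum_mul]
  refine Finset.sum_le_sum fun x _ => ?_
  rw [← Finset.sum_filter, ← Finset.mul_sum]
  refine mul_le_mul_of_nonneg_left ?_ (D.μ_pos x).le
  have hinj : Set.InjOn (fun R : Finset X => R.erase x)
      ((Finset.univ.filter fun R : Finset X => R.card = k + 1).filter fun R => x ∈ R) := by
    intro R hR R' hR' h
    simp only [Finset.coe_filter, Finset.mem_filter, Finset.mem_univ, true_and,
      Set.mem_ofPred_eq] at hR hR'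
    rw [← Finset.insert_erase hR.2, ← Finset.insert_erase hR'.2]
    exact congrArg (insert x) h
  refine le_trans (le_of_eq (Finset.sum_image
    (f := fun R => rowMinor (D.kernelSq q') Rᶜ) hinj).symm) ?_
  refine Finset.sum_le_sum_of_subset_of_nonneg (fun R hR => ?_)
    fun R _ _ => D.rowMinor_kernelSq_nonneg q' R
  simp only [Finset.mem_image, Finset.mem_filter, Finset.mem_univ, true_and] at hR ⊢
  obtain ⟨R', ⟨h1, h2⟩, rfl⟩ := hR
  rw [Finset.card_erase_of_mem h2, h1, Nat.add_sub_cancel]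

/-- `S = ∑_{i ≠ i₀} p'_i² (1 - p_i)²`. -/
def S (q q' : ℝ) : ℝ := ∑ i ∈ Finset.univ.erase D.i₀, D.p q' i ^ 2 * (1 - D.p q i) ^ 2

/-- `T = ∑_{i ≠ i₀} p_i² / p'_i²`. -/
def T (q q' : ℝ) : ℝ := ∑ i ∈ Finset.univ.erase D.i₀, D.p q i ^ 2 / D.p q' i ^ 2

/-- `V = ∑_{i ≠ i₀} p_i (1 - p_i)`. -/
def varSum (q : ℝ) : ℝ := ∑ i ∈ Finset.univ.erase D.i₀, D.p q i * (1 - D.p q i)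

/-- The generating function bound of the expected squeezing: the free parameter `y` weights the
number of roots. -/
theorem sum_sqrt_mul_sqrt_le (hμ : ∑ x, μ x = 1) {q q' : ℝ} (hq : 0 < q) (hq' : 0 < q') (k : ℕ)
    {y : ℝ} (hy : 0 < y) :
    ∑ R with R.card = k + 1, √(D.dualWeight q q' R) * √(D.traceNumerator q' R) ≤
      √(1 + 1 / y) * Real.exp ((y * D.T q q' + D.S q q' / y) / 2 - D.varSum q) := by
  let A := ∑ R with R.card = k + 1, D.dualWeight q q' R
  let B := ∑ R with R.card = k + 1, D.traceNumerator q' R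
  have hA0 : 0 ≤ A := Finset.sum_nonneg fun R _ => D.dualWeight_nonneg q q' R
  have hB0 : 0 ≤ B := Finset.sum_nonneg fun R _ => D.traceNumerator_nonneg q' R
  have hA : A * y ^ (k + 1) ≤
      y * ∏ i ∈ Finset.univ.erase D.i₀, (D.p q i ^ 2 / D.p q' i ^ 2 * y + (1 - D.p q i) ^ 2) := by
    have := sum_card_mixture_le D.orth (a := fun i => D.p q i ^ 2 / D.p q' i ^ 2)
      (b := fun i => (1 - D.p q i) ^ 2) (fun i => by positivity) (fun i => by positivity)
      hy.le (k + 1)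
    rw [← Finset.mul_prod_erase _ _ (Finset.mem_univ D.i₀)] at this
    refine this.trans (le_of_eq ?_)
    rw [D.p_zero hq, D.p_zero hq']
    norm_num
  have hB : B * (1 / y) ^ k ≤
      (1 + 1 / y) * ∏ i ∈ Finset.univ.erase D.i₀, (D.p q' i ^ 2 * (1 / y) + 1) := by
    have := sum_card_mixture_le D.orth (a := fun i => D.p q' i ^ 2)
      (b := fun _ => 1) (fun i => by positivity) (fun i => zero_le_one)
      (one_div_pos.2 hy).le k
    rw [← Finset.mul_prod_erase _ _ (Finset.mem_univ D.i₀)] at this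
    simp only [Finset.prod_const_one, mul_one, ← rowMinor_kernelSq] at this
    refine (mul_le_mul_of_nonneg_right (D.sum_traceNumerator_le hμ q' k)
      (by positivity)).trans (this.trans (le_of_eq ?_))
    rw [D.p_zero hq']; ring
  -- the cross terms of the two products give `exp (-2 p (1 - p))`
  have hprod : (∏ i ∈ Finset.univ.erase D.i₀,
        (D.p q i ^ 2 / D.p q' i ^ 2 * y + (1 - D.p q i) ^ 2)) *
      ∏ i ∈ Finset.univ.erase D.i₀, (D.p q' i ^ 2 * (1 / y) + 1) ≤
      Real.exp (y * D.T q q' + D.S q q' / y - 2 * D.varSum q) := by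
    rw [← Finset.prod_mul_distrib, T, S, varSum, Finset.mul_sum, Finset.sum_div, Finset.mul_sum,
      ← Finset.sum_add_distrib, ← Finset.sum_sub_distrib, Real.exp_sum]
    refine Finset.prod_le_prod (fun i _ => by positivity) fun i _ => ?_
    refine le_trans (le_of_eq ?_) (Real.add_one_le_exp _)
    have := (D.p_pos hq' i).ne'
    field_simp
    ring
  have hAB : A * B ≤ (1 + 1 / y) * Real.exp (y * D.T q q' + D.S q q' / y - 2 * D.varSum q) := by
    have h1 := mul_le_mul hA hB (by positivity) ((mul_nonneg hA0 (by positivity)).trans hA)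
    have h2 : A * y ^ (k + 1) * (B * (1 / y) ^ k) = y * (A * B) := by
      rw [one_div, inv_pow, pow_succ]; field_simp
    rw [h2] at h1
    refine le_of_mul_le_mul_left (h1.trans ?_) hy
    calc _ = y * ((1 + 1 / y) * ((∏ i ∈ Finset.univ.erase D.i₀,
          (D.p q i ^ 2 / D.p q' i ^ 2 * y + (1 - D.p q i) ^ 2)) *
          ∏ i ∈ Finset.univ.erase D.i₀, (D.p q' i ^ 2 * (1 / y) + 1))) := by ring
      _ ≤ _ := mul_le_mul_of_nonneg_left
        (mul_le_mul_of_nonneg_left hprod (by positivity)) hy.le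
  calc ∑ R with R.card = k + 1, √(D.dualWeight q q' R) * √(D.traceNumerator q' R)
      ≤ √A * √B := Real.sum_sqrt_mul_sqrt_le _ (fun R => D.dualWeight_nonneg q q' R)
        (fun R => D.traceNumerator_nonneg q' R)
    _ = √(A * B) := (Real.sqrt_mul hA0 B).symm
    _ ≤ √((1 + 1 / y) * Real.exp (y * D.T q q' + D.S q q' / y - 2 * D.varSum q)) :=
        Real.sqrt_le_sqrt hAB
    _ = _ := by
        rw [Real.sqrt_mul (by positivity), ← Real.exp_half]
        ring_nf

theorem sum_sqrt_mul_sqrt_le_min (hμ : ∑ x, μ x = 1) {q q' : ℝ} (hq : 0 < q) (hq' : 0 < q')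
    (hX : (Finset.univ.erase D.i₀).Nonempty) (k : ℕ) :
    ∑ R with R.card = k + 1, √(D.dualWeight q q' R) * √(D.traceNumerator q' R) ≤
      min (√(1 + √(D.T q q' / D.S q q')) * Real.exp (√(D.S q q' * D.T q q') - D.varSum q))
        (√(1 + D.T q q') * Real.exp ((1 + D.S q q' * D.T q q') / 2 - D.varSum q)) := by
  have hT : 0 < D.T q q' := Finset.sum_pos
    (fun i _ => div_pos (pow_pos (D.p_pos hq i) 2) (pow_pos (D.p_pos hq' i) 2)) hX
  have hS : 0 < D.S q q' := Finset.sum_pos (fun i hi => by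
    have hi' := D.pos i (Finset.ne_of_mem_erase hi)
    refine mul_pos (pow_pos (D.p_pos hq' i) 2) (pow_pos ?_ 2)
    rw [D.one_sub_p hq]
    positivity) hX
  refine le_min ?_ ?_
  · refine (D.sum_sqrt_mul_sqrt_le hμ hq hq' k
      (Real.sqrt_pos.2 (div_pos hS hT))).trans (le_of_eq ?_)
    have h1 : 1 / √(D.S q q' / D.T q q') = √(D.T q q' / D.S q q') := by
      rw [one_div, ← Real.sqrt_inv, inv_div]
    have h2 : √(D.S q q' / D.T q q') * D.T q q' = √(D.S q q' * D.T q q') := by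
      nth_rw 2 [← Real.sqrt_mul_self hT.le]
      rw [← Real.sqrt_mul (by positivity)]
      congr 1; field_simp
    have h3 : D.S q q' / √(D.S q q' / D.T q q') = √(D.S q q' * D.T q q') := by
      rw [div_eq_mul_one_div, h1]
      nth_rw 1 [← Real.sqrt_mul_self hS.le]
      rw [← Real.sqrt_mul (by positivity)]
      congr 1; field_simp
    rw [h1, h2, h3, add_self_div_two]
  · refine (D.sum_sqrt_mul_sqrt_le hμ hq hq' k (one_div_pos.2 hT)).trans (le_of_eq ?_)
    rw [one_div_one_div, div_div_eq_mul_div, div_one, one_div_mul_cancel hT.ne']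

end SpectralData

end Squeezing

/-! ### Expectations over the random forest -/

theorem integral_le_of_lintegral_ofReal_le {Ω : Type*} [MeasurableSpace Ω] {ν : Measure Ω}
    {f : Ω → ℝ} (hm : Measurable f) (hf : ∀ ω, 0 ≤ f ω) {c : ℝ} (hc : 0 ≤ c)
    (h : ∫⁻ ω, ENNReal.ofReal (f ω) ∂ν ≤ ENNReal.ofReal c) : ∫ ω, f ω ∂ν ≤ c := by
  rw [integral_eq_lintegral_of_nonneg_ae (.of_forall hf) hm.aestronglyMeasurable]
  exact ENNReal.toReal_le_of_le_ofReal hc h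

section Expectation

variable {X : Type*} [Fintype X] [DecidableEq X] {w : X → X → ℝ≥0} {q : ℝ}

theorem lintegral_forestLaw (hq : 0 < q) (f : Finset X → ℝ≥0∞) :
    ∫⁻ φ, f (roots φ) ∂forestLaw w q = ∑ R, ENNReal.ofReal (rootWeight w q R) * f R := by
  have hZ := partitionFunction_pos w hq
  rw [forestLaw, lintegral_finsetSum_measure, ← Finset.sum_fiberwise Finset.univ roots]
  refine Finset.sum_congr rfl fun R _ => ?_
  have h1 : rootWeight w q R =
      ∑ φ : SpanningForest w with roots φ = R, forestWeight q φ / partitionFunction w q := by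
    rw [rootWeight, ← sum_edgeWeight_roots_eq, Finset.mul_sum, Finset.sum_div]
    refine Finset.sum_congr rfl fun φ hφ => ?_
    rw [← (Finset.mem_filter.1 hφ).2]
    rfl
  have h2 : ∀ φ : SpanningForest w, 0 ≤ forestWeight q φ / partitionFunction w q := fun φ =>
    div_nonneg (mul_nonneg (by positivity) (edgeWeight_nonneg φ)) hZ.le
  rw [h1, ENNReal.ofReal_sum_of_nonneg fun φ _ => h2 φ, Finset.sum_mul]
  refine Finset.sum_congr rfl fun φ hφ => ?_
  rw [lintegral_smul_measure, lintegral_dirac' _ measurable_from_top, (Finset.mem_filter.1 hφ).2,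
    smul_eq_mul]

variable {Ω : Type*} [MeasurableSpace Ω] {Pq : Measure Ω} {Φ : Ω → SpanningForest w}

theorem lintegral_roots (hq : 0 < q) (hΦ : Measurable Φ) (hlaw : Pq.map Φ = forestLaw w q)
    (f : Finset X → ℝ≥0∞) :
    ∫⁻ ω, f (roots (Φ ω)) ∂Pq = ∑ R, ENNReal.ofReal (rootWeight w q R) * f R := by
  rw [← lintegral_forestLaw hq, ← hlaw, lintegral_map measurable_from_top hΦ]

theorem lintegral_cond_roots (hq : 0 < q) (hΦ : Measurable Φ)
    (hlaw : Pq.map Φ = forestLaw w q) (m : ℕ) (f : Finset X → ℝ≥0∞) :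
    ∫⁻ ω, f (roots (Φ ω)) ∂Pq[|{ω | (roots (Φ ω)).card = m}] =
      (Pq {ω | (roots (Φ ω)).card = m})⁻¹ *
        ∑ R with R.card = m, ENNReal.ofReal (rootWeight w q R) * f R := by
  have hs : MeasurableSet {ω | (roots (Φ ω)).card = m} :=
    hΦ (t := {φ | (roots φ).card = m}) trivial
  rw [ProbabilityTheory.cond, lintegral_smul_measure, smul_eq_mul, ← lintegral_indicator hs]
  congr 1
  have h1 := lintegral_roots hq hΦ hlaw (fun R => if R.card = m then f R else 0)
  simp only [mul_ite, mul_zero, ← Finset.sum_filter] at h1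
  rw [← h1]
  refine lintegral_congr fun ω => ?_
  simp [Set.indicator_apply]

theorem measure_card_roots (hq : 0 < q) (hΦ : Measurable Φ)
    (hlaw : Pq.map Φ = forestLaw w q) (m : ℕ) :
    Pq {ω | (roots (Φ ω)).card = m} =
      ENNReal.ofReal (∑ R with R.card = m, rootWeight w q R) := by
  have hs : MeasurableSet {ω | (roots (Φ ω)).card = m} :=
    hΦ (t := {φ | (roots φ).card = m}) trivial
  have h1 := lintegral_roots hq hΦ hlaw (fun R => if R.card = m then 1 else 0)
  simp only [mul_ite, mul_zero, mul_one, ← Finset.sum_filter] at h1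
  rw [ENNReal.ofReal_sum_of_nonneg fun R _ => rootWeight_nonneg w hq R, ← h1,
    ← lintegral_indicator_one hs]
  refine lintegral_congr fun ω => ?_
  simp [Set.indicator_apply]

theorem sum_ofReal_rootWeight_mul (hq : 0 < q) {g : Finset X → ℝ} (hg : ∀ R, 0 ≤ g R)
    (s : Finset (Finset X)) :
    ∑ R ∈ s, ENNReal.ofReal (rootWeight w q R) * ENNReal.ofReal (g R) =
      ENNReal.ofReal (∑ R ∈ s, rootWeight w q R * g R) := by
  rw [ENNReal.ofReal_sum_of_nonneg fun R _ => mul_nonneg (rootWeight_nonneg w hq R) (hg R)]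
  exact Finset.sum_congr rfl fun R _ => (ENNReal.ofReal_mul (rootWeight_nonneg w hq R)).symm

variable [MeasurableSpace X] [DiscreteMeasurableSpace X] {q' : ℝ}

theorem intertwiningError_nonneg (w : X → X → ℝ≥0) (q' : ℝ) (R : Finset X) :
    0 ≤ intertwiningError w q' R :=
  Finset.sum_nonneg fun _ _ => mul_nonneg (by norm_num)
    (Finset.sum_nonneg fun _ _ => abs_nonneg _)

theorem sum_card_rootWeight_mul_intertwiningError_le (hα : 0 < maxRate w)
    (hirr : (transitionMatrix w).IsIrreducible) (hq : 0 < q) (hq' : 0 < q') {m : ℕ} (hm : 1 ≤ m) :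
    ∑ R with R.card = m, rootWeight w q R * intertwiningError w q' R ≤
      q' * ((Fintype.card X : ℝ) - m) / maxRate w * ∑ R with R.card = m, rootWeight w q R := by
  have h1 : ∀ R ∈ (Finset.univ.filter fun R : Finset X => R.card = m),
      rootWeight w q R = q ^ m / partitionFunction w q * rowMinor (-generator w) R := by
    intro R hR
    rw [rootWeight, (Finset.mem_filter.1 hR).2]; ring
  have h2 := mul_le_mul_of_nonneg_left
    (sum_rowMinor_mul_intertwiningError_le hα hirr hq' hm)
    (div_nonneg (pow_nonneg hq.le m) (partitionFunction_pos w hq).le)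
  calc _ = q ^ m / partitionFunction w q *
        ∑ R with R.card = m, rowMinor (-generator w) R * intertwiningError w q' R := by
        rw [Finset.mul_sum]
        exact Finset.sum_congr rfl fun R hR => by rw [h1 R hR]; ring
    _ ≤ _ := h2
    _ = _ := by rw [Finset.sum_congr rfl h1, ← Finset.mul_sum]; ring

theorem sum_rootWeight_mul_intertwiningError_le [Nonempty X] (hα : 0 < maxRate w)
    (hirr : (transitionMatrix w).IsIrreducible) (hq : 0 < q) (hq' : 0 < q') :
    ∑ R, rootWeight w q R * intertwiningError w q' R ≤
      q' / maxRate w * ∑ R, rootWeight w q R * ((Fintype.card X : ℝ) - R.card) := by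
  have hmaps : ∀ R ∈ (Finset.univ : Finset (Finset X)),
      R.card ∈ Finset.range (Fintype.card X + 1) := fun R _ =>
    Finset.mem_range_succ_iff.2 (Finset.card_le_univ R)
  rw [← Finset.sum_fiberwise_of_maps_to hmaps, ← Finset.sum_fiberwise_of_maps_to hmaps
    (fun R => rootWeight w q R * ((Fintype.card X : ℝ) - R.card)), Finset.mul_sum]
  refine Finset.sum_le_sum fun m _ => ?_
  have h1 : q' / maxRate w *
      ∑ R with R.card = m, rootWeight w q R * ((Fintype.card X : ℝ) - R.card) =
      q' * ((Fintype.card X : ℝ) - m) / maxRate w * ∑ R with R.card = m, rootWeight w q R := by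
    rw [Finset.mul_sum, Finset.mul_sum]
    refine Finset.sum_congr rfl fun R hR => ?_
    rw [(Finset.mem_filter.1 hR).2]; ring
  rw [h1]
  rcases Nat.eq_zero_or_pos m with rfl | hm
  · -- a forest has at least one root
    have h0 : ∀ R ∈ (Finset.univ.filter fun R : Finset X => R.card = 0),
        rootWeight w q R = 0 := by
      intro R hR
      rw [rootWeight, Finset.card_eq_zero.1 (Finset.mem_filter.1 hR).2, rowMinor_empty,
        det_neg_generator, mul_zero, zero_div]
    rw [Finset.sum_eq_zero h0, mul_zero, Finset.sum_eq_zero fun R hR => by rw [h0 R hR, zero_mul]]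
  · exact sum_card_rootWeight_mul_intertwiningError_le hα hirr hq hq' hm

end Expectation

theorem SpectralData.erase_nonempty {X : Type*} [Fintype X] [DecidableEq X] {w : X → X → ℝ≥0}
    {μ : X → ℝ} (D : SpectralData w μ) (hα : 0 < maxRate w) :
    (Finset.univ.erase D.i₀).Nonempty := by
  by_contra h
  rw [Finset.not_nonempty_iff_eq_empty] at h
  have h1 : ∀ x, x = D.i₀ := fun x => by
    by_contra hx
    have : x ∈ Finset.univ.erase D.i₀ := Finset.mem_erase.2 ⟨hx, Finset.mem_univ x⟩
    rw [h] at this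
    simp at this
  refine hα.ne' (le_antisymm (Finset.sup_le fun x _ => ?_) bot_le)
  rw [exitRate, h1 x, h, Finset.sum_empty]

theorem SpectralData.sum_rootWeight_mul_squeezing_le {X : Type*} [Fintype X] [DecidableEq X]
    {w : X → X → ℝ≥0} {μ : X → ℝ} (D : SpectralData w μ) {q q' : ℝ} (hq : 0 < q) (hq' : 0 < q')
    (s : Finset (Finset X)) :
    ∑ R ∈ s, ENNReal.ofReal (rootWeight w q R) * squeezing μ (linkMatrix w q' R) ≤
      ENNReal.ofReal (∑ R ∈ s, √(D.dualWeight q q' R) * √(D.traceNumerator q' R)) := by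
  rw [ENNReal.ofReal_sum_of_nonneg fun R _ => by positivity]
  refine Finset.sum_le_sum fun R _ => ?_
  by_cases hR : rowMinor (D.kernelSq q') Rᶜ = 0
  · -- root sets whose rows are linearly dependent have probability zero
    have h1 := D.rootWeight_sq_le hq hq' R
    rw [hR, zero_mul] at h1
    have h2 : rootWeight w q R = 0 := by
      exact pow_eq_zero_iff two_ne_zero |>.1 (le_antisymm h1 (sq_nonneg _))
    rw [h2, ENNReal.ofReal_zero, zero_mul]
    exact zero_le
  · rw [D.squeezing_eq hq' hR, ← ENNReal.ofReal_mul (rootWeight_nonneg w hq R)]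
    exact ENNReal.ofReal_le_ofReal (D.rootWeight_mul_sqrt_le hq hq' R hR)

end

end ForestIntertwining

theorem mainTheorem1 {X : Type*} [Fintype X] [DecidableEq X] [MeasurableSpace X]
    [DiscreteMeasurableSpace X] (w : X → X → ℝ≥0) (μ : X → ℝ)
    (hα : 0 < maxRate w) (hirr : (transitionMatrix w).IsIrreducible) (hμ : IsReversible w μ)
    (q q' : ℝ) (hq : 0 < q) (hq' : 0 < q')
    {Ω : Type*} [MeasurableSpace Ω] (Pq : Measure Ω) [IsProbabilityMeasure Pq]
    (Φ : Ω → SpanningForest w) (hΦ : Measurable Φ) (hlaw : Pq.map Φ = forestLaw w q) :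
    (∀ m ∈ Finset.Icc 1 (Fintype.card X),
      ∫ ω, intertwiningError w q' (roots (Φ ω)) ∂Pq[|{ω | (roots (Φ ω)).card = m}]
        ≤ q' * ((Fintype.card X : ℝ) - (m : ℝ)) / (maxRate w : ℝ)) ∧
    (∫ ω, intertwiningError w q' (roots (Φ ω)) ∂Pq
        ≤ q' / (maxRate w : ℝ) *
          ∑ i ∈ Finset.Ico 1 (Fintype.card X), eigenvalue w i / (q + eigenvalue w i)) ∧
    (∀ m ∈ Finset.Icc 1 (Fintype.card X),
      ∫⁻ ω, squeezing μ (linkMatrix w q' (roots (Φ ω))) ∂Pq[|{ω | (roots (Φ ω)).card = m}]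
        ≤ ENNReal.ofReal
            (min
              (Real.sqrt (1 + Real.sqrt (sumT w q q' / sumS w q q')) *
                Real.exp (Real.sqrt (sumS w q q' * sumT w q q') - sumV w q))
              (Real.sqrt (1 + sumT w q q') *
                Real.exp ((1 + sumS w q q' * sumT w q q') / 2 - sumV w q))) /
          Pq {ω | (roots (Φ ω)).card = m}) := by
  obtain ⟨D⟩ := exists_spectralData hμ hirr
  have hX : Nonempty X := ⟨D.i₀⟩
  have hα' : 0 < (maxRate w : ℝ) := by exact_mod_cast hα
  have hmeas : Measurable fun ω => intertwiningError w q' (roots (Φ ω)) :=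
    (measurable_from_top
      (f := fun φ : SpanningForest w => intertwiningError w q' (roots φ))).comp hΦ
  have herr : ∀ ω, 0 ≤ intertwiningError w q' (roots (Φ ω)) := fun ω =>
    intertwiningError_nonneg w q' _
  refine ⟨fun m hm => ?_, ?_, fun m hm => ?_⟩
  · obtain ⟨hm1, hmn⟩ := Finset.mem_Icc.1 hm
    have hc : 0 ≤ q' * ((Fintype.card X : ℝ) - (m : ℝ)) / (maxRate w : ℝ) := by
      have : (m : ℝ) ≤ Fintype.card X := by exact_mod_cast hmn
      exact div_nonneg (mul_nonneg hq'.le (sub_nonneg.2 this)) hα'.le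
    refine integral_le_of_lintegral_ofReal_le hmeas herr hc ?_
    rw [lintegral_cond_roots hq hΦ hlaw m fun R => ENNReal.ofReal (intertwiningError w q' R),
      sum_ofReal_rootWeight_mul hq (intertwiningError_nonneg w q'),
      measure_card_roots hq hΦ hlaw]
    refine (mul_le_mul_right (ENNReal.ofReal_le_ofReal
      (sum_card_rootWeight_mul_intertwiningError_le hα hirr hq hq' hm1)) _).trans ?_
    rw [ENNReal.ofReal_mul hc, mul_left_comm]
    exact mul_le_of_le_one_right' (ENNReal.inv_mul_le_one _)
  · have h1 := D.sum_Ico fun t => t / (q + t)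
    rw [h1]
    refine integral_le_of_lintegral_ofReal_le hmeas herr ?_ ?_
    · refine mul_nonneg (div_nonneg hq'.le hα'.le) (Finset.sum_nonneg fun i _ => ?_)
      have := D.l_nonneg i
      positivity
    · rw [lintegral_roots hq hΦ hlaw fun R => ENNReal.ofReal (intertwiningError w q' R),
        sum_ofReal_rootWeight_mul hq (intertwiningError_nonneg w q'), ← D.sum_rootWeight_mul hq]
      exact ENNReal.ofReal_le_ofReal (sum_rootWeight_mul_intertwiningError_le hα hirr hq hq')
  · obtain ⟨k, rfl⟩ : ∃ k, m = k + 1 := ⟨m - 1, by have := (Finset.mem_Icc.1 hm).1; omega⟩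
    have hS : sumS w q q' = D.S q q' :=
      D.sum_Ico fun t => (q' / (q' + t)) ^ 2 * (1 - q / (q + t)) ^ 2
    have hT : sumT w q q' = D.T q q' :=
      D.sum_Ico fun t => (q / (q + t)) ^ 2 / (q' / (q' + t)) ^ 2
    have hV : sumV w q = D.varSum q :=
      D.sum_Ico fun t => (q / (q + t)) * (1 - q / (q + t))
    rw [lintegral_cond_roots hq hΦ hlaw (k + 1) fun R => squeezing μ (linkMatrix w q' R),
      hS, hT, hV, ENNReal.div_eq_inv_mul]
    refine mul_le_mul_right ((D.sum_rootWeight_mul_squeezing_le hq hq' _).trans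
      (ENNReal.ofReal_le_ofReal ?_)) _
    exact D.sum_sqrt_mul_sqrt_le_min hμ.sum_eq_one hq hq' (D.erase_nonempty hα) k
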